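/- Let $\mathcal T$ be a generalized algebraic theory (GAT), that is, a $\{I^{\mathsf{ty}},I^{\mathsf{tm}},E^{\mathsf{tm}}\}$-cellular $\Sigma$-CwF: $\mathcal T$ is a category with families (CwF) with $\mathbf 1$- and $\Sigma$-types stable under substitution, and the map to $\mathcal T$ from the initial $\Sigma$-CwF is a transfinite composition of pushouts of coproducts of generic extensions by a type, by a term, or by an equation between two terms of the same type. All morphisms of $\Sigma$-CwFs preserve the structure strictly. A model of $\mathcal T$ is a $\Sigma$-CwF morphism $\mathcal M:\mathcal T\to\mathbf{Set}$, and a morphism of models is a natural transformation $F:\mathcal M\Rightarrow\mathcal N$. It acts on closed sorts $X\in\mathcal T$ by $F_X:\mathcal M_X\to\mathcal N_X$ and on dependent sorts $(X\vdash Y\ \mathsf{type})$ by $F_Y:\mathcal M_Y(x)\to\mathcal N_Y(F_X(x))$, where $F_{X.Y}(x,y)=(F_X(x),F_Y(y))$. The morphism $F$ is a non-split trivial fibration if every map $F_Y:\mathcal M_Y(x)\to\mathcal N_Y(F_X(x))$, for $(X\vdash Y\ \mathsf{type})\in\mathcal T$ and $x\in\mathcal M_X$, is surjective. Let $\mathbf{Setoid}$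 be the $\Sigma$-CwF of setoids, whose types are dependent setoids (families of sets with a dependent equivalence relation), and let $U:\mathbf{Setoid}\to\mathbf{Set}$ be the forgetful morphism. A congruence over $\mathcal M$ is a $\Sigma$-CwF morphism $\widetilde{\mathcal M}:\mathcal T\to\mathbf{Setoid}$ with $U\circ\widetilde{\mathcal M}=\mathcal M$. It is fibrant if for every dependent sort $(X\vdash Y\ \mathsf{type})$, all $x_1\sim x_2$ in $\widetilde{\mathcal M}_X$ and every $y_1\in\mathcal M_Y(x_1)$, there is $y_2\in\mathcal M_Y(x_2)$ with $y_1\sim y_2$ in $\widetilde{\mathcal M}_Y$. The kernel $\ker_F$ is the congruence over $\mathcal M$ with $x_1\sim x_2$ iff $F_X(x_1)=F_X(x_2)$, and, over such $x_1\sim x_2$, $y_1\sim y_2$ iff $F_Y(y_1)=F_Y(y_2)$. A quotient of a congruence $\widetilde{\mathcal M}$ is a morphism of models $q:\mathcal M\to\mathcal Q$ with $\widetilde{\mathcal M}\subseteq\ker_q$ such that every morphism $G:\mathcal M\to\mathcal N'$ with $\widetilde{\mathcal M}\subseteq\ker_G$ factors uniquely through $q$. Then, for every morphism $F:\mathcal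 M\to\mathcal N$ of models of $\mathcal T$: 1. If $F$ is a non-split trivial fibration, then $\ker_F$ is a fibrant congruence and $(\mathcal N,F)$ is a quotient of $\ker_F$. In particular, for every quotient $q:\mathcal M\to\mathcal Q$ of $\ker_F$ there is an isomorphism $e:\mathcal Q\cong\mathcal N$ with $e\circ q=F$. 2. $F$ is a non-split trivial fibration if and only if there are a fibrant congruence $\widetilde{\mathcal M}$ over $\mathcal M$, a quotient $q:\mathcal M\to\mathcal Q$ of $\widetilde{\mathcal M}$ and an isomorphism $e:\mathcal Q\cong\mathcal N$ with $e\circ q=F$. -/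

import Mathlib

open CategoryTheory

universe u v w w'

namespace GAT

/-! ### Categories with families -/

/-- A category with families: a category with a chosen terminal object, a presheaf `Ty` of types,
a presheaf `Tm` of terms with a natural map `tp` giving the type of a term, and chosen context
extensions (that is, `tp` is locally representable). The terms of type `A` in context `Γ` are the
`a : Tm Γ` with `tp a = A`. -/
structure CwF : Type (max (u + 1) (v + 1)) where
  Ob : Type u
  [cat : Category.{v} Ob]
  one : Ob
  toOne (Γ : Ob) : Γ ⟶ one
  toOne_uniq {Γ : Ob} (f : Γ ⟶ one) : f = toOne Γ
  Ty : Ob → Type u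
  tySub {Γ Δ : Ob} (f : Δ ⟶ Γ) (A : Ty Γ) : Ty Δ
  tySub_id {Γ : Ob} (A : Ty Γ) : tySub (𝟙 Γ) A = A
  tySub_comp {Γ Δ Θ : Ob} (g : Θ ⟶ Δ) (f : Δ ⟶ Γ) (A : Ty Γ) :
    tySub (g ≫ f) A = tySub g (tySub f A)
  Tm : Ob → Type u
  tmSub {Γ Δ : Ob} (f : Δ ⟶ Γ) (a : Tm Γ) : Tm Δ
  tmSub_id {Γ : Ob} (a : Tm Γ) : tmSub (𝟙 Γ) a = a
  tmSub_comp {Γ Δ Θ : Ob} (g : Θ ⟶ Δ) (f : Δ ⟶ Γ) (a : Tm Γ) :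
    tmSub (g ≫ f) a = tmSub g (tmSub f a)
  tp {Γ : Ob} (a : Tm Γ) : Ty Γ
  tp_sub {Γ Δ : Ob} (f : Δ ⟶ Γ) (a : Tm Γ) : tp (tmSub f a) = tySub f (tp a)
  ext {Γ : Ob} (A : Ty Γ) : Ob
  p {Γ : Ob} (A : Ty Γ) : ext A ⟶ Γ
  q {Γ : Ob} (A : Ty Γ) : Tm (ext A)
  tp_q {Γ : Ob} (A : Ty Γ) : tp (q A) = tySub (p A) A
  pair {Γ Δ : Ob} {A : Ty Γ} (f : Δ ⟶ Γ) (a : Tm Δ) (h : tp a = tySub f A) : Δ ⟶ ext A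
  pair_p {Γ Δ : Ob} {A : Ty Γ} (f : Δ ⟶ Γ) (a : Tm Δ) (h : tp a = tySub f A) :
    pair f a h ≫ p A = f
  pair_q {Γ Δ : Ob} {A : Ty Γ} (f : Δ ⟶ Γ) (a : Tm Δ) (h : tp a = tySub f A) :
    tmSub (pair f a h) (q A) = a
  pair_uniq {Γ Δ : Ob} {A : Ty Γ} {g g' : Δ ⟶ ext A} (hp : g ≫ p A = g' ≫ p A)
    (hq : tmSub g (q A) = tmSub g' (q A)) : g = g'

attribute [instance] CwF.cat

/-- The map `Δ.A[f] ⟶ Γ.A` induced by `f : Δ ⟶ Γ`. -/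
def CwF.lift (C : CwF.{u, v}) {Γ Δ : C.Ob} (f : Δ ⟶ Γ) (A : C.Ty Γ) :
    C.ext (C.tySub f A) ⟶ C.ext A :=
  C.pair (C.p (C.tySub f A) ≫ f) (C.q (C.tySub f A)) (by rw [C.tp_q, C.tySub_comp])

/-- The map `⟨id, a⟩ : Γ ⟶ Γ.A` given by a term `a` of type `A`. -/
def CwF.sec (C : CwF.{u, v}) {Γ : C.Ob} {A : C.Ty Γ} (a : C.Tm Γ) (h : C.tp a = A) :
    Γ ⟶ C.ext A :=
  C.pair (𝟙 Γ) a (by rw [h, C.tySub_id])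

/-- A CwF with `1`- and `Σ`-types, all stable under substitution. For `Σ`-types, terms of
`sig A B` correspond naturally to pairs of a term `a` of `A` and a term of `B[⟨id, a⟩]`. -/
structure SigmaCwF : Type (max (u + 1) (v + 1)) extends CwF.{u, v} where
  unit (Γ : Ob) : Ty Γ
  unit_sub {Γ Δ : Ob} (f : Δ ⟶ Γ) : tySub f (unit Γ) = unit Δ
  star (Γ : Ob) : Tm Γ
  tp_star (Γ : Ob) : tp (star Γ) = unit Γ
  star_uniq {Γ : Ob} (a : Tm Γ) (h : tp a = unit Γ) : a = star Γ
  sig {Γ : Ob} (A : Ty Γ) (B : Ty (ext A)) : Ty Γ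
  sig_sub {Γ Δ : Ob} (f : Δ ⟶ Γ) (A : Ty Γ) (B : Ty (ext A)) :
    tySub f (sig A B) = sig (tySub f A) (tySub (toCwF.lift f A) B)
  dpair {Γ : Ob} {A : Ty Γ} (B : Ty (ext A)) (a b : Tm Γ) (ha : tp a = A)
    (hb : tp b = tySub (toCwF.sec a ha) B) : Tm Γ
  tp_dpair {Γ : Ob} {A : Ty Γ} (B : Ty (ext A)) (a b : Tm Γ) (ha : tp a = A)
    (hb : tp b = tySub (toCwF.sec a ha) B) : tp (dpair B a b ha hb) = sig A B
  fst {Γ : Ob} {A : Ty Γ} {B : Ty (ext A)} (c : Tm Γ) (h : tp c = sig A B) : Tm Γ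
  tp_fst {Γ : Ob} {A : Ty Γ} {B : Ty (ext A)} (c : Tm Γ) (h : tp c = sig A B) :
    tp (fst c h) = A
  snd {Γ : Ob} {A : Ty Γ} {B : Ty (ext A)} (c : Tm Γ) (h : tp c = sig A B) : Tm Γ
  tp_snd {Γ : Ob} {A : Ty Γ} {B : Ty (ext A)} (c : Tm Γ) (h : tp c = sig A B) :
    tp (snd c h) = tySub (toCwF.sec (fst c h) (tp_fst c h)) B
  fst_dpair {Γ : Ob} {A : Ty Γ} (B : Ty (ext A)) (a b : Tm Γ) (ha : tp a = A)
    (hb : tp b = tySub (toCwF.sec a ha) B) : fst (dpair B a b ha hb) (tp_dpair B a b ha hb) = a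
  snd_dpair {Γ : Ob} {A : Ty Γ} (B : Ty (ext A)) (a b : Tm Γ) (ha : tp a = A)
    (hb : tp b = tySub (toCwF.sec a ha) B) : snd (dpair B a b ha hb) (tp_dpair B a b ha hb) = b
  dpair_eta {Γ : Ob} {A : Ty Γ} {B : Ty (ext A)} (c : Tm Γ) (h : tp c = sig A B) :
    dpair B (fst c h) (snd c h) (tp_fst c h) (tp_snd c h) = c
  fst_sub {Γ Δ : Ob} (f : Δ ⟶ Γ) {A : Ty Γ} {B : Ty (ext A)} (c : Tm Γ) (h : tp c = sig A B)
    (h' : tp (tmSub f c) = sig (tySub f A) (tySub (toCwF.lift f A) B)) :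
    fst (tmSub f c) h' = tmSub f (fst c h)
  snd_sub {Γ Δ : Ob} (f : Δ ⟶ Γ) {A : Ty Γ} {B : Ty (ext A)} (c : Tm Γ) (h : tp c = sig A B)
    (h' : tp (tmSub f c) = sig (tySub f A) (tySub (toCwF.lift f A) B)) :
    snd (tmSub f c) h' = tmSub f (snd c h)

/-- A (strict) morphism of `Σ`-CwFs. -/
@[ext]
structure SigmaCwF.Hom (C : SigmaCwF.{u, v}) (D : SigmaCwF.{w, w'}) where
  func : C.Ob ⥤ D.Ob
  ty {Γ : C.Ob} (A : C.Ty Γ) : D.Ty (func.obj Γ)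
  tm {Γ : C.Ob} (a : C.Tm Γ) : D.Tm (func.obj Γ)
  ty_sub {Γ Δ : C.Ob} (f : Δ ⟶ Γ) (A : C.Ty Γ) :
    ty (C.tySub f A) = D.tySub (func.map f) (ty A)
  tm_sub {Γ Δ : C.Ob} (f : Δ ⟶ Γ) (a : C.Tm Γ) :
    tm (C.tmSub f a) = D.tmSub (func.map f) (tm a)
  tp_tm {Γ : C.Ob} (a : C.Tm Γ) : D.tp (tm a) = ty (C.tp a)
  one_eq : func.obj C.one = D.one
  ext_eq {Γ : C.Ob} (A : C.Ty Γ) : func.obj (C.ext A) = D.ext (ty A)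
  p_eq {Γ : C.Ob} (A : C.Ty Γ) : func.map (C.p A) = eqToHom (ext_eq A) ≫ D.p (ty A)
  q_eq {Γ : C.Ob} (A : C.Ty Γ) : tm (C.q A) = D.tmSub (eqToHom (ext_eq A)) (D.q (ty A))
  unit_eq (Γ : C.Ob) : ty (C.unit Γ) = D.unit (func.obj Γ)
  sig_eq {Γ : C.Ob} (A : C.Ty Γ) (B : C.Ty (C.ext A)) :
    ty (C.sig A B) = D.sig (ty A) (D.tySub (eqToHom (ext_eq A).symm) (ty B))
  fst_eq {Γ : C.Ob} {A : C.Ty Γ} {B : C.Ty (C.ext A)} (c : C.Tm Γ) (h : C.tp c = C.sig A B)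
    (h' : D.tp (tm c) = D.sig (ty A) (D.tySub (eqToHom (ext_eq A).symm) (ty B))) :
    tm (C.fst c h) = D.fst (tm c) h'
  snd_eq {Γ : C.Ob} {A : C.Ty Γ} {B : C.Ty (C.ext A)} (c : C.Tm Γ) (h : C.tp c = C.sig A B)
    (h' : D.tp (tm c) = D.sig (ty A) (D.tySub (eqToHom (ext_eq A).symm) (ty B))) :
    tm (C.snd c h) = D.snd (tm c) h'

namespace SigmaCwF

theorem ext_congr (C : SigmaCwF.{u, v}) {Γ Δ : C.Ob} (h : Γ = Δ) (A : C.Ty Δ) :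
    C.ext (C.tySub (eqToHom h) A) = C.ext A := by
  subst h; simp [C.tySub_id]

def Hom.id (C : SigmaCwF.{u, v}) : Hom C C where
  func := 𝟭 _
  ty A := A
  tm a := a
  ty_sub _ _ := rfl
  tm_sub _ _ := rfl
  tp_tm _ := rfl
  one_eq := rfl
  ext_eq _ := rfl
  p_eq A := by simp
  q_eq A := by simp [C.tmSub_id]
  unit_eq _ := rfl
  sig_eq A B := by simp [C.tySub_id]
  fst_eq {_ A B} c h h' := by
    have : ∀ (B' : C.Ty (C.ext A)) (_ : B' = B) (h' : C.tp c = C.sig A B'),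
        C.fst c h = C.fst c h' := by rintro _ rfl _; rfl
    exact this _ (by simp [C.tySub_id]) h'
  snd_eq {_ A B} c h h' := by
    have : ∀ (B' : C.Ty (C.ext A)) (_ : B' = B) (h' : C.tp c = C.sig A B'),
        C.snd c h = C.snd c h' := by rintro _ rfl _; rfl
    exact this _ (by simp [C.tySub_id]) h'

universe u₁ u₂ u₃ v₁ v₂ v₃

section comp

variable {C : SigmaCwF.{u₁, v₁}} {D : SigmaCwF.{u₂, v₂}} {E : SigmaCwF.{u₃, v₃}}

theorem comp_sig_aux (F : Hom C D) (G : Hom D E) {Γ : C.Ob} (A : C.Ty Γ) (B : C.Ty (C.ext A))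
    (h : E.ext (G.ty (F.ty A)) = G.func.obj (F.func.obj (C.ext A))) :
    E.tySub (eqToHom (G.ext_eq (F.ty A)).symm)
        (G.ty (D.tySub (eqToHom (F.ext_eq A).symm) (F.ty B))) =
      E.tySub (eqToHom h) (G.ty (F.ty B)) := by
  rw [G.ty_sub, ← E.tySub_comp, eqToHom_map, eqToHom_trans]

def Hom.comp (F : Hom C D) (G : Hom D E) : Hom C E where
  func := F.func ⋙ G.func
  ty A := G.ty (F.ty A)
  tm a := G.tm (F.tm a)
  ty_sub f A := by rw [F.ty_sub, G.ty_sub]; rfl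
  tm_sub f A := by rw [F.tm_sub, G.tm_sub]; rfl
  tp_tm a := by rw [G.tp_tm, F.tp_tm]
  one_eq := by simp [F.one_eq, G.one_eq]
  ext_eq A := by simp [F.ext_eq, G.ext_eq]
  p_eq A := by simp [F.p_eq, G.p_eq, eqToHom_map]
  q_eq A := by
    rw [F.q_eq, G.tm_sub, G.q_eq, ← E.tmSub_comp, eqToHom_map, eqToHom_trans]
  unit_eq Γ := by rw [F.unit_eq, G.unit_eq]; rfl
  sig_eq A B := by
    rw [F.sig_eq, G.sig_eq, comp_sig_aux]
  fst_eq {Γ A B} c h h' := by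
    have e := F.fst_eq c h (by rw [F.tp_tm, h, F.sig_eq])
    rw [e]
    have e' := G.fst_eq (F.tm c) (by rw [F.tp_tm, h, F.sig_eq])
      (by rw [G.tp_tm, F.tp_tm, h, F.sig_eq, G.sig_eq])
    rw [e']
    congr 1
    exact comp_sig_aux F G A B _
  snd_eq {Γ A B} c h h' := by
    have e := F.snd_eq c h (by rw [F.tp_tm, h, F.sig_eq])
    rw [e]
    have e' := G.snd_eq (F.tm c) (by rw [F.tp_tm, h, F.sig_eq])
      (by rw [G.tp_tm, F.tp_tm, h, F.sig_eq, G.sig_eq])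
    rw [e']
    congr 1
    exact comp_sig_aux F G A B _

end comp

/-- The 1-category of `Σ`-CwFs and strict morphisms. -/
instance : Category SigmaCwF.{u, v} where
  Hom := Hom
  id := Hom.id
  comp := Hom.comp

end SigmaCwF

/-! ### Generalized algebraic theories -/

section Cellular

/-- `C` is freely generated, as a `Σ`-CwF, by the context `Γ`. -/
def IsFreeOb (C : SigmaCwF.{u, u}) (Γ : C.Ob) : Prop :=
  ∀ (D : SigmaCwF.{u, u}) (Δ : D.Ob), ∃! F : C ⟶ D, F.func.obj Γ = Δ

/-- `C` is freely generated, as a `Σ`-CwF, by `Γ ⊢ A type`. -/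
def IsFreeTy (C : SigmaCwF.{u, u}) (Γ : C.Ob) (A : C.Ty Γ) : Prop :=
  ∀ (D : SigmaCwF.{u, u}) (Δ : D.Ob) (B : D.Ty Δ),
    ∃! F : C ⟶ D, (⟨F.func.obj Γ, F.ty A⟩ : Σ Δ, D.Ty Δ) = ⟨Δ, B⟩

/-- `C` is freely generated, as a `Σ`-CwF, by `Γ ⊢ a : A`, where `A = tp a`. -/
def IsFreeTm (C : SigmaCwF.{u, u}) (Γ : C.Ob) (a : C.Tm Γ) : Prop :=
  ∀ (D : SigmaCwF.{u, u}) (Δ : D.Ob) (b : D.Tm Δ),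
    ∃! F : C ⟶ D, (⟨F.func.obj Γ, F.tm a⟩ : Σ Δ, D.Tm Δ) = ⟨Δ, b⟩

/-- `C` is freely generated, as a `Σ`-CwF, by `Γ ⊢ x, y : A`, where `A = tp x = tp y`. -/
def IsFreeTmTm (C : SigmaCwF.{u, u}) (Γ : C.Ob) (x y : C.Tm Γ) : Prop :=
  C.tp x = C.tp y ∧
    ∀ (D : SigmaCwF.{u, u}) (Δ : D.Ob) (x' y' : D.Tm Δ), D.tp x' = D.tp y' →
      ∃! F : C ⟶ D, (⟨F.func.obj Γ, F.tm x, F.tm y⟩ : Σ Δ, D.Tm Δ × D.Tm Δ) = ⟨Δ, x', y'⟩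

/-- `C` is freely generated, as a `Σ`-CwF, by `Γ ⊢ x, y : A` subject to `x = y`. -/
def IsFreeTmEq (C : SigmaCwF.{u, u}) (Γ : C.Ob) (x y : C.Tm Γ) : Prop :=
  x = y ∧
    ∀ (D : SigmaCwF.{u, u}) (Δ : D.Ob) (x' y' : D.Tm Δ), x' = y' →
      ∃! F : C ⟶ D, (⟨F.func.obj Γ, F.tm x, F.tm y⟩ : Σ Δ, D.Tm Δ × D.Tm Δ) = ⟨Δ, x', y'⟩

/-- The generic extension by a type, `Free(Γ ⊢) ⟶ Free(Γ ⊢ A type)`. -/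
def ITy : MorphismProperty SigmaCwF.{u, u} := fun C D i =>
  ∃ (Γ : C.Ob) (A : D.Ty (i.func.obj Γ)), IsFreeOb C Γ ∧ IsFreeTy D (i.func.obj Γ) A

/-- The generic extension by a term, `Free(Γ ⊢ A type) ⟶ Free(Γ ⊢ a : A)`. -/
def ITm : MorphismProperty SigmaCwF.{u, u} := fun C D i =>
  ∃ (Γ : C.Ob) (A : C.Ty Γ) (a : D.Tm (i.func.obj Γ)), D.tp a = i.ty A ∧
    IsFreeTy C Γ A ∧ IsFreeTm D (i.func.obj Γ) a

/-- The generic extension by an equation between terms,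
`Free(Γ ⊢ x, y : A) ⟶ Free(Γ ⊢ x = y)`. -/
def ETm : MorphismProperty SigmaCwF.{u, u} := fun C D i =>
  ∃ (Γ : C.Ob) (x y : C.Tm Γ), IsFreeTmTm C Γ x y ∧
    IsFreeTmEq D (i.func.obj Γ) (i.tm x) (i.tm y)

/-- A generalized algebraic theory: an `{ITy, ITm, ETm}`-cellular `Σ`-CwF, i.e. the map from the
initial `Σ`-CwF is a transfinite composition of pushouts of coproducts of such maps. -/
def IsGAT (T : SigmaCwF.{u, u}) : Prop :=
  ∃ (Z : SigmaCwF.{u, u}) (_ : Limits.IsInitial Z) (f : Z ⟶ T),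
    MorphismProperty.transfiniteCompositions.{u}
      (MorphismProperty.coproducts.{u} (ITy.{u} ⊔ ITm.{u} ⊔ ETm.{u})).pushouts f

end Cellular

/-! ### The `Σ`-CwFs of sets and of setoids -/

/-- The `Σ`-CwF of sets: types are families of sets, terms are sections. -/
@[reducible]
def SetCwF : SigmaCwF.{v + 1, v} where
  Ob := Type v
  one := PUnit
  toOne _ := ↾fun _ => PUnit.unit
  toOne_uniq _ := rfl
  Ty X := X → Type v
  tySub f A := fun x => A (f x)
  tySub_id _ := rfl
  tySub_comp _ _ _ := rfl
  Tm X := Σ A : X → Type v, ∀ x, A x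
  tmSub f a := ⟨fun x => a.1 (f x), fun x => a.2 (f x)⟩
  tmSub_id _ := rfl
  tmSub_comp _ _ _ := rfl
  tp a := a.1
  tp_sub _ _ := rfl
  ext {X} A := Σ x : X, A x
  p _ := ↾fun z => z.1
  q A := ⟨fun z => A z.1, fun z => z.2⟩
  tp_q _ := rfl
  pair f a h := ↾fun x => ⟨f x, cast (congrFun h x) (a.2 x)⟩
  pair_p _ _ _ := rfl
  pair_q f a h := by
    obtain ⟨A, a⟩ := a
    cases h
    rfl
  pair_uniq {X Y A g g'} hp hq := by
    have key : ∀ x : Y, g x = g' x := fun x => by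
      have hp' : (g x).1 = (g' x).1 := congrArg (fun k : Y ⟶ X => k x) hp
      have h2 : ∀ (s t : Σ A : Y → Type v, ∀ x, A x), s = t → HEq (s.2 x) (t.2 x) := by
        rintro s _ rfl; rfl
      exact Sigma.ext hp' (h2 _ _ hq)
    exact ConcreteCategory.hom_ext _ _ key
  unit _ := fun _ => PUnit
  unit_sub _ := rfl
  star _ := ⟨fun _ => PUnit, fun _ => PUnit.unit⟩
  tp_star _ := rfl
  star_uniq a h := by
    obtain ⟨A, a⟩ := a
    cases h
    rfl
  sig A B := fun x => Σ a : A x, B ⟨x, a⟩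
  sig_sub _ _ _ := rfl
  dpair {X A} B a b ha hb := ⟨fun x => Σ a : A x, B ⟨x, a⟩,
    fun x => ⟨cast (congrFun ha x) (a.2 x), cast (congrFun hb x) (b.2 x)⟩⟩
  tp_dpair _ _ _ _ _ := rfl
  fst {X A B} c h := ⟨A, fun x => (cast (congrFun h x) (c.2 x)).1⟩
  tp_fst _ _ := rfl
  snd {X A B} c h := ⟨fun x => B ⟨x, (cast (congrFun h x) (c.2 x)).1⟩,
    fun x => (cast (congrFun h x) (c.2 x)).2⟩
  tp_snd _ _ := rfl
  fst_dpair B a b ha hb := by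
    obtain ⟨A, a⟩ := a
    cases ha
    rfl
  snd_dpair B a b ha hb := by
    obtain ⟨A, a⟩ := a
    obtain ⟨B', b⟩ := b
    cases ha
    cases hb
    rfl
  dpair_eta c h := by
    obtain ⟨C, c⟩ := c
    cases h
    rfl
  fst_sub _ _ _ _ _ _ := rfl
  snd_sub _ _ _ _ _ _ := rfl

/-- A setoid. -/
structure SetoidObj : Type (v + 1) where
  carrier : Type v
  rel : carrier → carrier → Prop
  iseqv : Equivalence rel

/-- Morphisms of setoids: functions preserving the equivalence relations. -/
@[ext]
structure SetoidObj.Hom (X Y : SetoidObj.{v}) where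
  toFun : X.carrier → Y.carrier
  resp {x₁ x₂ : X.carrier} (h : X.rel x₁ x₂) : Y.rel (toFun x₁) (toFun x₂)

instance : Category SetoidObj.{v} where
  Hom := SetoidObj.Hom
  id X := ⟨fun x => x, fun h => h⟩
  comp f g := ⟨fun x => g.toFun (f.toFun x), fun h => g.resp (f.resp h)⟩

/-- A dependent setoid over a setoid `X`: a family of sets with a dependent equivalence
relation over that of `X`. -/
@[ext]
structure DepSetoid (X : SetoidObj.{v}) : Type (v + 1) where
  fam : X.carrier → Type v
  rel {x₁ x₂ : X.carrier} (h : X.rel x₁ x₂) : fam x₁ → fam x₂ → Prop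
  refl {x : X.carrier} (y : fam x) : rel (X.iseqv.refl x) y y
  symm {x₁ x₂ : X.carrier} {h : X.rel x₁ x₂} {y₁ : fam x₁} {y₂ : fam x₂} :
    rel h y₁ y₂ → rel (X.iseqv.symm h) y₂ y₁
  trans {x₁ x₂ x₃ : X.carrier} {h : X.rel x₁ x₂} {h' : X.rel x₂ x₃}
    {y₁ : fam x₁} {y₂ : fam x₂} {y₃ : fam x₃} :
    rel h y₁ y₂ → rel h' y₂ y₃ → rel (X.iseqv.trans h h') y₁ y₃

/-- A dependent equivalence relation is fibrant if elements can be transported, up to the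
relation, along related elements of the base. -/
def DepSetoid.IsFibrant {X : SetoidObj.{v}} (Y : DepSetoid X) : Prop :=
  ∀ (x₁ x₂ : X.carrier) (h : X.rel x₁ x₂) (y₁ : Y.fam x₁), ∃ y₂ : Y.fam x₂, Y.rel h y₁ y₂

/-- Terms of a dependent setoid: sections that preserve the relations. -/
@[ext]
structure DepSetoid.Section {X : SetoidObj.{v}} (A : DepSetoid X) : Type v where
  toFun (x : X.carrier) : A.fam x
  resp {x₁ x₂ : X.carrier} (h : X.rel x₁ x₂) : A.rel h (toFun x₁) (toFun x₂)

def DepSetoid.Section.cast {X : SetoidObj.{v}} {A B : DepSetoid X} (h : A = B) (a : A.Section) :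
    B.Section := h ▸ a

/-- Reindexing of a dependent setoid along a morphism of setoids. -/
def DepSetoid.sub {X Y : SetoidObj.{v}} (f : SetoidObj.Hom Y X) (A : DepSetoid X) :
    DepSetoid Y where
  fam x := A.fam (f.toFun x)
  rel h := A.rel (f.resp h)
  refl y := A.refl y
  symm h := A.symm h
  trans h h' := A.trans h h'

/-- The total setoid of a dependent setoid. -/
def DepSetoid.total {X : SetoidObj.{v}} (A : DepSetoid X) : SetoidObj.{v} where
  carrier := Σ x : X.carrier, A.fam x
  rel z₁ z₂ := ∃ h : X.rel z₁.1 z₂.1, A.rel h z₁.2 z₂.2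
  iseqv := ⟨fun z => ⟨_, A.refl z.2⟩, fun ⟨_, h⟩ => ⟨_, A.symm h⟩,
    fun ⟨_, h⟩ ⟨_, h'⟩ => ⟨_, A.trans h h'⟩⟩

def SetoidObj.unit : SetoidObj.{v} where
  carrier := PUnit
  rel _ _ := True
  iseqv := ⟨fun _ => trivial, fun _ => trivial, fun _ _ => trivial⟩

def DepSetoid.unit (X : SetoidObj.{v}) : DepSetoid X where
  fam _ := PUnit
  rel _ _ _ := True
  refl _ := trivial
  symm _ := trivial
  trans _ _ := trivial

def DepSetoid.sig {X : SetoidObj.{v}} (A : DepSetoid X) (B : DepSetoid A.total) :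
    DepSetoid X where
  fam x := Σ a : A.fam x, B.fam ⟨x, a⟩
  rel {x₁ x₂} h c₁ c₂ :=
    ∃ h' : A.rel h c₁.1 c₂.1, B.rel (x₁ := ⟨x₁, c₁.1⟩) (x₂ := ⟨x₂, c₂.1⟩) ⟨h, h'⟩ c₁.2 c₂.2
  refl c := ⟨A.refl c.1, B.refl c.2⟩
  symm := fun ⟨k, h⟩ => ⟨A.symm k, B.symm h⟩
  trans := fun ⟨k, h⟩ ⟨k', h'⟩ => ⟨A.trans k k', B.trans h h'⟩

def DepSetoid.Section.sub {X Y : SetoidObj.{v}} (f : SetoidObj.Hom Y X) {A : DepSetoid X}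
    (a : A.Section) : (A.sub f).Section :=
  ⟨fun x => a.toFun (f.toFun x), fun h => a.resp (f.resp h)⟩

def DepSetoid.proj {X : SetoidObj.{v}} (A : DepSetoid X) : SetoidObj.Hom A.total X :=
  ⟨fun z => z.1, fun h => h.1⟩

def DepSetoid.generic {X : SetoidObj.{v}} (A : DepSetoid X) : (A.sub A.proj).Section :=
  ⟨fun z => z.2, fun h => h.2⟩

def DepSetoid.pair {X Y : SetoidObj.{v}} {A : DepSetoid X} (f : SetoidObj.Hom Y X)
    (a : (A.sub f).Section) : SetoidObj.Hom Y A.total :=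
  ⟨fun x => ⟨f.toFun x, a.toFun x⟩, fun h => ⟨f.resp h, a.resp h⟩⟩

def DepSetoid.Section.fst {X : SetoidObj.{v}} {A : DepSetoid X} {B : DepSetoid A.total}
    (c : (A.sig B).Section) : A.Section where
  toFun x := Sigma.fst (c.toFun x)
  resp h := Exists.fst (c.resp h)

def DepSetoid.Section.snd {X : SetoidObj.{v}} {A : DepSetoid X} {B : DepSetoid A.total}
    (c : (A.sig B).Section) :
    (B.sub (DepSetoid.pair (𝟙 X : SetoidObj.Hom X X) c.fst)).Section where
  toFun x := Sigma.snd (c.toFun x)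
  resp h := Exists.snd (c.resp h)

def DepSetoid.Section.dpair {X : SetoidObj.{v}} {A : DepSetoid X} {B : DepSetoid A.total}
    (a : A.Section) (b : (B.sub (DepSetoid.pair (𝟙 X : SetoidObj.Hom X X) a)).Section) :
    (A.sig B).Section where
  toFun x := ⟨a.toFun x, b.toFun x⟩
  resp h := ⟨a.resp h, b.resp h⟩

/-- The `Σ`-CwF of setoids. -/
@[reducible]
def SetoidCwF : SigmaCwF.{v + 1, v} where
  Ob := SetoidObj.{v}
  one := SetoidObj.unit
  toOne X := SetoidObj.Hom.mk (X := X) (Y := SetoidObj.unit) (fun _ => PUnit.unit)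
    fun _ => trivial
  toOne_uniq _ := rfl
  Ty X := DepSetoid X
  tySub f A := A.sub f
  tySub_id _ := rfl
  tySub_comp _ _ _ := rfl
  Tm X := Σ A : DepSetoid X, A.Section
  tmSub f a := ⟨a.1.sub f, a.2.sub f⟩
  tmSub_id _ := rfl
  tmSub_comp _ _ _ := rfl
  tp a := a.1
  tp_sub _ _ := rfl
  ext A := A.total
  p A := A.proj
  q A := ⟨A.sub A.proj, A.generic⟩
  tp_q _ := rfl
  pair f a h := DepSetoid.pair f (a.2.cast h)
  pair_p _ _ _ := rfl
  pair_q f a h := by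
    obtain ⟨A, a⟩ := a
    cases h
    rfl
  pair_uniq {X Y A g g'} hp hq := by
    apply SetoidObj.Hom.ext
    funext x
    have hp' : (SetoidObj.Hom.toFun g x).1 = (SetoidObj.Hom.toFun g' x).1 :=
      congrFun (congrArg SetoidObj.Hom.toFun hp) x
    have h2 : ∀ (s t : Σ A : DepSetoid Y, A.Section), s = t →
        HEq (s.2.toFun x) (t.2.toFun x) := by
      rintro s _ rfl; rfl
    exact Sigma.ext hp' (h2 _ _ hq)
  unit X := DepSetoid.unit X
  unit_sub _ := rfl
  star X := ⟨DepSetoid.unit X, ⟨fun _ => PUnit.unit, fun _ => trivial⟩⟩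
  tp_star _ := rfl
  star_uniq a h := by
    obtain ⟨A, a⟩ := a
    cases h
    rfl
  sig A B := A.sig B
  sig_sub _ _ _ := rfl
  dpair {X A} B a b ha hb :=
    ⟨A.sig B, DepSetoid.Section.dpair (a.2.cast ha)
      (b.2.cast (hb.trans (by obtain ⟨A, a⟩ := a; cases ha; rfl)))⟩
  tp_dpair _ _ _ _ _ := rfl
  fst {X A B} c h := ⟨A, (c.2.cast h).fst⟩
  tp_fst _ _ := rfl
  snd {X A B} c h := ⟨_, (c.2.cast h).snd⟩
  tp_snd _ _ := rfl
  fst_dpair B a b ha hb := by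
    obtain ⟨A, a⟩ := a
    cases ha
    rfl
  snd_dpair B a b ha hb := by
    obtain ⟨A, a⟩ := a
    obtain ⟨B', b⟩ := b
    cases ha
    cases hb
    rfl
  dpair_eta c h := by
    obtain ⟨C, c⟩ := c
    cases h
    rfl
  fst_sub f _ _ c h h' := by
    obtain ⟨C, c⟩ := c
    cases h
    rfl
  snd_sub f _ _ c h h' := by
    obtain ⟨C, c⟩ := c
    cases h
    rfl

/-- The forgetful morphism `U : Setoid ⟶ Set`. -/
def forgetSetoid : SigmaCwF.Hom SetoidCwF.{v} SetCwF.{v} where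
  func :=
    { obj := fun X => SetoidObj.carrier X
      map := fun f => ↾(SetoidObj.Hom.toFun f) }
  ty A := DepSetoid.fam A
  tm a := ⟨DepSetoid.fam a.1, DepSetoid.Section.toFun a.2⟩
  ty_sub _ _ := rfl
  tm_sub _ _ := rfl
  tp_tm _ := rfl
  one_eq := rfl
  ext_eq _ := rfl
  p_eq _ := rfl
  q_eq _ := rfl
  unit_eq _ := rfl
  sig_eq _ _ := rfl
  fst_eq c h _ := by
    obtain ⟨C, c⟩ := c
    cases h
    rfl
  snd_eq c h _ := by
    obtain ⟨C, c⟩ := c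
    cases h
    rfl

/-! ### Models -/

/-- A model of `T` is a `Σ`-CwF morphism `T ⟶ Set`. -/
abbrev Model (T : SigmaCwF.{u, w}) := SigmaCwF.Hom T SetCwF.{v}

namespace Model

variable {T : SigmaCwF.{u, w}}

/-- Morphisms of models are natural transformations. -/
instance : Category (Model.{u, v, w} T) where
  Hom M N := NatTrans (SigmaCwF.Hom.func M) (SigmaCwF.Hom.func N)
  id M := NatTrans.id (SigmaCwF.Hom.func M)
  comp F G := NatTrans.vcomp F G

/-- The set of elements of a closed sort. -/
def El (M : Model.{u, v, w} T) (X : T.Ob) : Type v := (SigmaCwF.Hom.func M).obj X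

/-- The action of a model on morphisms. -/
def map (M : Model.{u, v, w} T) {X X' : T.Ob} (f : X ⟶ X') (x : M.El X) : M.El X' :=
  (SigmaCwF.Hom.func M).map f x

/-- The family of sets of elements of a dependent sort. -/
def Fam (M : Model.{u, v, w} T) {X : T.Ob} (Y : T.Ty X) : M.El X → Type v :=
  SigmaCwF.Hom.ty M Y

theorem El_ext (M : Model.{u, v, w} T) {X : T.Ob} (Y : T.Ty X) :
    M.El (T.ext Y) = Σ x : M.El X, M.Fam Y x :=
  SigmaCwF.Hom.ext_eq M Y

/-- The element `(x, y)` of `M_{X.Y}`. -/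
def mk (M : Model.{u, v, w} T) {X : T.Ob} (Y : T.Ty X) (x : M.El X) (y : M.Fam Y x) :
    M.El (T.ext Y) :=
  cast (M.El_ext Y).symm ⟨x, y⟩

/-- The components of an element of `M_{X.Y}`. -/
def split (M : Model.{u, v, w} T) {X : T.Ob} (Y : T.Ty X) (z : M.El (T.ext Y)) :
    Σ x : M.El X, M.Fam Y x :=
  cast (M.El_ext Y) z

@[simp]
theorem split_mk (M : Model.{u, v, w} T) {X : T.Ob} (Y : T.Ty X) (x : M.El X) (y : M.Fam Y x) :
    M.split Y (M.mk Y x y) = ⟨x, y⟩ := by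
  simp [split, mk]

@[simp]
theorem mk_split (M : Model.{u, v, w} T) {X : T.Ob} (Y : T.Ty X) (z : M.El (T.ext Y)) :
    M.mk Y (M.split Y z).1 (M.split Y z).2 = z := by
  simp [split, mk]

theorem split_injective (M : Model.{u, v, w} T) {X : T.Ob} (Y : T.Ty X) :
    Function.Injective (M.split Y) := fun a b h => by
  rw [← M.mk_split Y a, ← M.mk_split Y b, h]

theorem map_comp (M : Model.{u, v, w} T) {X X' X'' : T.Ob} (f : X ⟶ X') (g : X' ⟶ X'')
    (x : M.El X) : M.map (f ≫ g) x = M.map g (M.map f x) := by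
  unfold map
  rw [Functor.map_comp]
  rfl

theorem map_p (M : Model.{u, v, w} T) {X : T.Ob} (Y : T.Ty X) (z : M.El (T.ext Y)) :
    M.map (T.p Y) z = (M.split Y z).1 := by
  have h := SigmaCwF.Hom.p_eq M Y
  have e : ∀ {A B : Type v} (h : A = B) (a : A), (eqToHom h : A ⟶ B) a = cast h a := by
    rintro A _ rfl a; simp
  unfold map
  rw [h]
  exact congrArg Sigma.fst (e _ _)

theorem Fam_sub (M : Model.{u, v, w} T) {X X' : T.Ob} (f : X' ⟶ X) (Y : T.Ty X) :
    M.Fam (T.tySub f Y) = fun x => M.Fam Y (M.map f x) :=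
  SigmaCwF.Hom.ty_sub M f Y

theorem tp_tm (M : Model.{u, v, w} T) {X : T.Ob} (a : T.Tm X) :
    Sigma.fst (SigmaCwF.Hom.tm M a) = M.Fam (T.tp a) :=
  SigmaCwF.Hom.tp_tm M a

/-- The value of a term at an element of its context. -/
def val (M : Model.{u, v, w} T) {X : T.Ob} (a : T.Tm X) (x : M.El X) : M.Fam (T.tp a) x :=
  cast (congrFun (M.tp_tm a) x) (Sigma.snd (SigmaCwF.Hom.tm M a) x)

theorem val_heq (M : Model.{u, v, w} T) {X : T.Ob} (a : T.Tm X) (x : M.El X) :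
    HEq (M.val a x) (Sigma.snd (SigmaCwF.Hom.tm M a) x) :=
  cast_heq _ _

theorem heq_snd_of_eq {X : Type v} {s t : Σ A : X → Type v, ∀ x, A x} (h : s = t) (x : X) :
    HEq (s.2 x) (t.2 x) := by
  subst h; rfl

theorem val_sub (M : Model.{u, v, w} T) {X X' : T.Ob} (f : X' ⟶ X) (a : T.Tm X) (x : M.El X') :
    HEq (M.val (T.tmSub f a) x) (M.val a (M.map f x)) :=
  (M.val_heq _ _).trans ((heq_snd_of_eq (SigmaCwF.Hom.tm_sub M f a) x).trans
    (M.val_heq _ _).symm)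

theorem val_q (M : Model.{u, v, w} T) {X : T.Ob} (Y : T.Ty X) (z : M.El (T.ext Y)) :
    HEq (M.val (T.q Y) z) (M.split Y z).2 := by
  have e : ∀ {A B : Type v} (h : A = B) (a : A), (eqToHom h : A ⟶ B) a = cast h a := by
    rintro A _ rfl a; simp
  have h := heq_snd_of_eq (SigmaCwF.Hom.q_eq M Y) z
  refine (M.val_heq _ _).trans (h.trans ?_)
  have h2 : ∀ s t : Σ x : M.El X, M.Fam Y x, s = t → HEq s.2 t.2 := by
    rintro s _ rfl; rfl
  exact h2 _ _ (e _ _)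

theorem split_pair (M : Model.{u, v, w} T) {X X' : T.Ob} {Y : T.Ty X} (f : X' ⟶ X) (a : T.Tm X')
    (h : T.tp a = T.tySub f Y) (x : M.El X') (y : M.Fam Y (M.map f x)) (hy : HEq y (M.val a x)) :
    M.split Y (M.map (T.pair f a h) x) = ⟨M.map f x, y⟩ := by
  refine Sigma.ext ?_ ?_
  · rw [← map_p, ← map_comp, T.pair_p]
  · refine HEq.trans ?_ hy.symm
    refine (M.val_q Y _).symm.trans ?_
    refine (M.val_sub _ _ _).symm.trans ?_
    rw [T.pair_q]

/-- Naturality on elements. -/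
theorem nat {M N : Model.{u, v, w} T} (F : M ⟶ N) {X X' : T.Ob} (f : X ⟶ X') (x : M.El X) :
    NatTrans.app F X' (M.map f x) = N.map f (NatTrans.app F X x) :=
  congrArg (fun k : M.El X ⟶ N.El X' => k x) (NatTrans.naturality F f)

/-- The action `F_X : M_X → N_X` of a morphism of models on a closed sort. -/
def act {M N : Model.{u, v, w} T} (F : M ⟶ N) (X : T.Ob) (x : M.El X) : N.El X :=
  NatTrans.app F X x

theorem act_map {M N : Model.{u, v, w} T} (F : M ⟶ N) {X X' : T.Ob} (f : X ⟶ X') (x : M.El X) :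
    act F X' (M.map f x) = N.map f (act F X x) :=
  nat F f x

theorem split_act_fst {M N : Model.{u, v, w} T} (F : M ⟶ N) {X : T.Ob} (Y : T.Ty X)
    (x : M.El X) (y : M.Fam Y x) :
    (N.split Y (act F (T.ext Y) (M.mk Y x y))).1 = act F X x := by
  rw [← map_p, ← act_map, map_p, split_mk]

/-- The action `F_Y : M_Y(x) → N_Y(F_X(x))` of a morphism of models on a dependent sort, which is
determined by `F_{X.Y}(x, y) = (F_X(x), F_Y(y))`. -/
def dact {M N : Model.{u, v, w} T} (F : M ⟶ N) {X : T.Ob} (Y : T.Ty X) (x : M.El X)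
    (y : M.Fam Y x) : N.Fam Y (act F X x) :=
  cast (congrArg (N.Fam Y) (split_act_fst F Y x y))
    (N.split Y (act F (T.ext Y) (M.mk Y x y))).2

theorem act_mk {M N : Model.{u, v, w} T} (F : M ⟶ N) {X : T.Ob} (Y : T.Ty X) (x : M.El X)
    (y : M.Fam Y x) : act F (T.ext Y) (M.mk Y x y) = N.mk Y (act F X x) (dact F Y x y) := by
  apply N.split_injective
  rw [split_mk]
  exact Sigma.ext (split_act_fst F Y x y) (cast_heq _ _).symm

/-- A (non-split) trivial fibration: every `F_Y : M_Y(x) → N_Y(F_X(x))` is surjective. -/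
def IsTrivialFibration {M N : Model.{u, v, w} T} (F : M ⟶ N) : Prop :=
  ∀ (X : T.Ob) (Y : T.Ty X) (x : M.El X), Function.Surjective (dact F Y x)

end Model

/-! ### Congruences -/

/-- A congruence over `M` is a `Σ`-CwF morphism `T ⟶ Setoid` lying over `M`. -/
structure Congruence {T : SigmaCwF.{u, w}} (M : Model.{u, v, w} T) where
  hom : SigmaCwF.Hom T SetoidCwF.{v}
  hom_forget : hom.comp forgetSetoid = M

namespace Congruence

variable {T : SigmaCwF.{u, w}} {M : Model.{u, v, w} T}

/-- The setoid associated with a closed sort. -/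
def ob (K : Congruence M) (X : T.Ob) : SetoidObj.{v} := K.hom.func.obj X

/-- The dependent setoid associated with a dependent sort. -/
def dep (K : Congruence M) {X : T.Ob} (Y : T.Ty X) : DepSetoid (K.ob X) := K.hom.ty Y

theorem carrier_eq (K : Congruence M) (X : T.Ob) : (K.ob X).carrier = M.El X := by
  obtain ⟨K, rfl⟩ := K; rfl

theorem fam_eq (K : Congruence M) {X : T.Ob} (Y : T.Ty X) (x : M.El X) :
    (K.dep Y).fam (cast (K.carrier_eq X).symm x) = M.Fam Y x := by
  obtain ⟨K, rfl⟩ := K; rfl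

/-- The equivalence relation on `M_X`, for a closed sort `X`. -/
def Rel (K : Congruence M) (X : T.Ob) (x₁ x₂ : M.El X) : Prop :=
  (K.ob X).rel (cast (K.carrier_eq X).symm x₁) (cast (K.carrier_eq X).symm x₂)

/-- The dependent equivalence relation on `M_Y`, for a dependent sort `Y` over `X`; it lies
over the relation on `M_X`. -/
def DepRel (K : Congruence M) {X : T.Ob} (Y : T.Ty X) {x₁ x₂ : M.El X} (h : K.Rel X x₁ x₂)
    (y₁ : M.Fam Y x₁) (y₂ : M.Fam Y x₂) : Prop :=
  (K.dep Y).rel h (cast (K.fam_eq Y x₁).symm y₁) (cast (K.fam_eq Y x₂).symm y₂)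

/-- Inclusion of congruences over the same model. -/
def Le (K L : Congruence M) : Prop :=
  (∀ (X : T.Ob) (x₁ x₂ : M.El X), K.Rel X x₁ x₂ → L.Rel X x₁ x₂) ∧
  ∀ (X : T.Ob) (Y : T.Ty X) (x₁ x₂ : M.El X) (y₁ : M.Fam Y x₁) (y₂ : M.Fam Y x₂)
    (h : K.Rel X x₁ x₂), K.DepRel Y h y₁ y₂ → ∃ h' : L.Rel X x₁ x₂, L.DepRel Y h' y₁ y₂

/-- A congruence is fibrant if all its dependent equivalence relations are. -/
def IsFibrant (K : Congruence M) : Prop :=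
  ∀ (X : T.Ob) (Y : T.Ty X), (K.dep Y).IsFibrant

end Congruence

/-! ### Kernels -/

theorem SetoidObj.ext' {A B : SetoidObj.{v}} (h : A.carrier = B.carrier)
    (hr : ∀ a a', A.rel a a' ↔ B.rel (cast h a) (cast h a')) : A = B := by
  obtain ⟨A, r, _⟩ := A
  obtain ⟨B, r', _⟩ := B
  cases h
  have : r = r' := by
    funext a a'
    exact propext (hr a a')
  cases this
  rfl

theorem DepSetoid.ext' {X : SetoidObj.{v}} {A B : DepSetoid X} (h : A.fam = B.fam)
    (hr : ∀ (x x' : X.carrier) (k : X.rel x x') (a : A.fam x) (a' : A.fam x'),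
      A.rel k a a' ↔ B.rel k (cast (congrFun h x) a) (cast (congrFun h x') a')) : A = B := by
  obtain ⟨A, r, _, _, _⟩ := A
  obtain ⟨B, r', _, _, _⟩ := B
  cases h
  have : @r = @r' := by
    funext x x' k a a'
    exact propext (hr x x' k a a')
  cases this
  rfl

theorem forgetSetoid_map_injective {X Y : SetoidObj.{v}} {f g : X ⟶ Y}
    (h : forgetSetoid.func.map f = forgetSetoid.func.map g) : f = g := by
  apply SetoidObj.Hom.ext
  funext x
  exact congrArg (fun k : X.carrier ⟶ Y.carrier => k x) h

theorem setoid_tm_ext {X : SetoidObj.{v}} {a b : Σ A : DepSetoid X, A.Section}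
    (h : a.1 = b.1) (h' : SigmaCwF.Hom.tm forgetSetoid (Γ := X) a = forgetSetoid.tm b) :
    a = b := by
  obtain ⟨A, a⟩ := a
  obtain ⟨B, b⟩ := b
  cases h
  have : a = b := by
    apply DepSetoid.Section.ext
    funext x
    exact eq_of_heq (Model.heq_snd_of_eq h' x)
  rw [this]

namespace Model

variable {T : SigmaCwF.{u, w}} {M N : Model.{u, v, w} T}

/-- The equivalence relation of the kernel on a closed sort. -/
@[reducible]
def kerOb (F : M ⟶ N) (X : T.Ob) : SetoidObj.{v} where
  carrier := M.El X
  rel x₁ x₂ := act F X x₁ = act F X x₂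
  iseqv := ⟨fun _ => rfl, Eq.symm, Eq.trans⟩

/-- The dependent equivalence relation of the kernel on a dependent sort: `y₁ ∼ y₂` over
`x₁ ∼ x₂` if `F_Y(y₁) = F_Y(y₂)`, where the two sides are compared along
`F_X(x₁) = F_X(x₂)`. -/
@[reducible]
def kerTy (F : M ⟶ N) {X : T.Ob} (Y : T.Ty X) : DepSetoid (kerOb F X) where
  fam := M.Fam Y
  rel {x₁ x₂} _ y₁ y₂ := HEq (dact F Y x₁ y₁) (dact F Y x₂ y₂)
  refl _ := HEq.rfl
  symm := HEq.symm
  trans := HEq.trans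

theorem kerTy_rel_iff (F : M ⟶ N) {X : T.Ob} (Y : T.Ty X) {x₁ x₂ : M.El X}
    (h : act F X x₁ = act F X x₂) (y₁ : M.Fam Y x₁) (y₂ : M.Fam Y x₂) :
    HEq (dact F Y x₁ y₁) (dact F Y x₂ y₂) ↔
      act F (T.ext Y) (M.mk Y x₁ y₁) = act F (T.ext Y) (M.mk Y x₂ y₂) := by
  rw [act_mk, act_mk]
  constructor
  · intro h'
    rw [← (N.split_injective Y).eq_iff, split_mk, split_mk]
    exact Sigma.ext h h'
  · intro h'
    rw [← (N.split_injective Y).eq_iff, split_mk, split_mk] at h'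
    exact (Sigma.ext_iff.1 h').2

theorem dact_congr (F : M ⟶ N) {X : T.Ob} {Y Y' : T.Ty X} (hY : Y = Y') {x x' : M.El X}
    (hx : x = x') {y : M.Fam Y x} {y' : M.Fam Y' x'} (hy : HEq y y') :
    HEq (dact F Y x y) (dact F Y' x' y') := by
  subst hY; subst hx; cases hy; rfl

theorem mk_congr (M : Model.{u, v, w} T) {X : T.Ob} (Y : T.Ty X) {x x' : M.El X}
    (hx : x = x') {y : M.Fam Y x} {y' : M.Fam Y x'} (hy : HEq y y') :
    M.mk Y x y = M.mk Y x' y' := by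
  subst hx; cases hy; rfl

theorem mk_inj (M : Model.{u, v, w} T) {X : T.Ob} (Y : T.Ty X) {x x' : M.El X}
    {y : M.Fam Y x} {y' : M.Fam Y x'} (h : M.mk Y x y = M.mk Y x' y') : HEq y y' := by
  rw [← (M.split_injective Y).eq_iff, split_mk, split_mk] at h
  exact (Sigma.ext_iff.1 h).2

theorem map_pair (M : Model.{u, v, w} T) {X X' : T.Ob} {Y : T.Ty X} (f : X' ⟶ X) (a : T.Tm X')
    (h : T.tp a = T.tySub f Y) (x : M.El X') (y : M.Fam Y (M.map f x)) (hy : HEq y (M.val a x)) :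
    M.map (T.pair f a h) x = M.mk Y (M.map f x) y := by
  apply M.split_injective
  rw [M.split_pair f a h x y hy, split_mk]

theorem map_lift (M : Model.{u, v, w} T) {X X' : T.Ob} (f : X' ⟶ X) (Y : T.Ty X) (x : M.El X')
    (y : M.Fam (T.tySub f Y) x) (y' : M.Fam Y (M.map f x)) (hy : HEq y y') :
    M.map (T.lift f Y) (M.mk _ x y) = M.mk Y (M.map f x) y' := by
  have h1 : M.map (T.p (T.tySub f Y) ≫ f) (M.mk _ x y) = M.map f x := by
    rw [map_comp, map_p, split_mk]
  unfold CwF.lift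
  have h2 : M.Fam Y (M.map f x) = M.Fam Y (M.map (T.p (T.tySub f Y) ≫ f) (M.mk _ x y)) := by
    rw [h1]
  rw [M.map_pair _ _ _ _ (cast h2 y')]
  · exact M.mk_congr Y h1 (cast_heq _ _)
  · refine (cast_heq _ _).trans (hy.symm.trans ?_)
    refine HEq.trans ?_ (M.val_q _ _).symm
    rw [split_mk]

theorem dact_sub (F : M ⟶ N) {X X' : T.Ob} (f : X' ⟶ X) (Y : T.Ty X) (x : M.El X')
    (y : M.Fam (T.tySub f Y) x) (y' : M.Fam Y (M.map f x)) (hy : HEq y y') :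
    HEq (dact F (T.tySub f Y) x y) (dact F Y (M.map f x) y') := by
  have h1 := act_map F (T.lift f Y) (M.mk _ x y)
  rw [M.map_lift f Y x y y' hy, act_mk, act_mk] at h1
  have h2 : N.Fam (T.tySub f Y) (act F X' x) = N.Fam Y (N.map f (act F X' x)) :=
    congrFun (N.Fam_sub f Y) _
  rw [N.map_lift f Y (act F X' x) (dact F _ x y) (cast h2 (dact F _ x y)) (cast_heq _ _).symm]
    at h1
  exact (cast_heq _ _).symm.trans (N.mk_inj Y h1).symm

theorem dact_val (F : M ⟶ N) {X : T.Ob} (a : T.Tm X) (x : M.El X) :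
    HEq (dact F (T.tp a) x (M.val a x)) (N.val a (act F X x)) := by
  have key : ∀ (L : Model.{u, v, w} T) (x : L.El X),
      L.map (T.sec a rfl) x = L.mk (T.tp a) x (L.val a x) := by
    intro L x
    have h1 : L.map (𝟙 X) x = x := by
      unfold map
      rw [CategoryTheory.Functor.map_id]
      rfl
    have h2 : L.Fam (T.tp a) x = L.Fam (T.tp a) (L.map (𝟙 X) x) := by rw [h1]
    unfold CwF.sec
    rw [L.map_pair _ _ _ _ (cast h2 (L.val a x)) (cast_heq _ _)]
    exact L.mk_congr _ h1 (cast_heq _ _)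
  have h := act_map F (T.sec a rfl) x
  rw [key, key, act_mk] at h
  exact N.mk_inj _ h

theorem eqToHom_apply' {A B : Type v} (h : A = B) (a : A) : (eqToHom h : A ⟶ B) a = cast h a := by
  subst h; simp

theorem Fam_unit (M : Model.{u, v, w} T) (X : T.Ob) : M.Fam (T.unit X) = fun _ => PUnit :=
  SigmaCwF.Hom.unit_eq M X

theorem Fam_sig (M : Model.{u, v, w} T) {X : T.Ob} (A : T.Ty X) (B : T.Ty (T.ext A)) :
    M.Fam (T.sig A B) = fun x => Σ a : M.Fam A x, M.Fam B (M.mk A x a) := by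
  have h : M.Fam (T.sig A B) = fun x => Σ a : M.Fam A x,
      M.Fam B ((eqToHom (M.El_ext A).symm : (Σ x : M.El X, M.Fam A x) ⟶ M.El (T.ext A)) ⟨x, a⟩) :=
    SigmaCwF.Hom.sig_eq M A B
  rw [h]
  funext x
  simp only [eqToHom_apply']
  rfl

theorem sigma_heq {A A' : Type v} {P : A → Type v} {Q : A' → Type v} (hA : A = A') (h : HEq P Q)
    {s : Σ a, P a} {t : Σ a, Q a} (hs : HEq s t) : HEq s.1 t.1 ∧ HEq s.2 t.2 := by
  subst hA; cases h; cases hs; exact ⟨HEq.rfl, HEq.rfl⟩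

theorem sigma_heq_mk {A A' : Type v} {P : A → Type v} {Q : A' → Type v} (hA : A = A')
    (h : HEq P Q) {s : Σ a, P a} {t : Σ a, Q a} (h1 : HEq s.1 t.1) (h2 : HEq s.2 t.2) :
    HEq s t := by
  subst hA; cases h; exact heq_of_eq (Sigma.ext (eq_of_heq h1) h2)

theorem val_fst_snd (M : Model.{u, v, w} T) {X : T.Ob} {A : T.Ty X} {B : T.Ty (T.ext A)}
    (c : T.Tm X) (h : T.tp c = T.sig A B) (x : M.El X)
    (s : Σ a : M.Fam A x, M.Fam B (M.mk A x a)) (hs : HEq s (M.val c x)) :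
    HEq (M.val (T.fst c h) x) s.1 ∧ HEq (M.val (T.snd c h) x) s.2 := by
  have h' := (SigmaCwF.Hom.tp_tm M c).trans ((congrArg _ h).trans (SigmaCwF.Hom.sig_eq M A B))
  have e1 := heq_snd_of_eq (SigmaCwF.Hom.fst_eq M c h h') x
  have e2 := heq_snd_of_eq (SigmaCwF.Hom.snd_eq M c h h') x
  have hP : (fun a : M.Fam A x => M.Fam B (M.mk A x a)) = fun a : M.Fam A x =>
      M.Fam B ((eqToHom (M.El_ext A).symm : (Σ x : M.El X, M.Fam A x) ⟶ M.El (T.ext A))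
        ⟨x, a⟩) := by
    funext a
    rw [eqToHom_apply']
    rfl
  have e3 := sigma_heq (A := M.Fam A x) rfl (heq_of_eq hP) (s := s)
    (t := cast (congrFun h' x) (Sigma.snd (SigmaCwF.Hom.tm M c) x))
    (hs.trans ((M.val_heq c x).trans (cast_heq _ _).symm))
  exact ⟨(M.val_heq _ _).trans (e1.trans e3.1.symm), (M.val_heq _ _).trans (e2.trans e3.2.symm)⟩

/-- The action of a morphism of models on `Σ`-types is componentwise; first for the values of a
term. -/
theorem dact_sig_val (F : M ⟶ N) {X : T.Ob} {A : T.Ty X} {B : T.Ty (T.ext A)}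
    (c : T.Tm X) (h : T.tp c = T.sig A B) (x : M.El X)
    (s : Σ a : M.Fam A x, M.Fam B (M.mk A x a)) (hs : HEq s (M.val c x))
    (t : Σ a : N.Fam A (act F X x), N.Fam B (N.mk A (act F X x) a))
    (ht : HEq t (N.val c (act F X x))) :
    HEq (dact F A x s.1) t.1 ∧ HEq (dact F B (M.mk A x s.1) s.2) t.2 := by
  obtain ⟨m1, m2⟩ := M.val_fst_snd c h x s hs
  obtain ⟨n1, n2⟩ := N.val_fst_snd c h (act F X x) t ht
  have k1 : HEq (dact F A x s.1) t.1 :=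
    (dact_congr F (T.tp_fst c h).symm rfl m1.symm).trans ((dact_val F (T.fst c h) x).trans n1)
  refine ⟨k1, ?_⟩
  have e : M.map (T.sec (T.fst c h) (T.tp_fst c h)) x = M.mk A x s.1 := by
    have h1 : M.map (𝟙 X) x = x := by
      unfold map
      rw [CategoryTheory.Functor.map_id]
      rfl
    have h2 : M.Fam A x = M.Fam A (M.map (𝟙 X) x) := by rw [h1]
    unfold CwF.sec
    rw [M.map_pair _ _ _ _ (cast h2 s.1) ((cast_heq _ _).trans m1.symm)]
    exact M.mk_congr _ h1 (cast_heq _ _)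
  have h3 : M.Fam (T.tySub (T.sec (T.fst c h) (T.tp_fst c h)) B) x = M.Fam B (M.mk A x s.1) := by
    rw [Fam_sub]; simp only [e]
  have h4 : M.Fam B (M.mk A x s.1) = M.Fam B (M.map (T.sec (T.fst c h) (T.tp_fst c h)) x) := by
    rw [e]
  have d1 := dact_sub F (T.sec (T.fst c h) (T.tp_fst c h)) B x (cast h3.symm s.2) (cast h4 s.2)
    ((cast_heq _ _).trans (cast_heq _ _).symm)
  have d2 : HEq (dact F B (M.mk A x s.1) s.2)
      (dact F B (M.map (T.sec (T.fst c h) (T.tp_fst c h)) x) (cast h4 s.2)) :=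
    dact_congr F rfl e.symm (cast_heq _ _).symm
  refine d2.trans (d1.symm.trans (HEq.trans ?_ ((dact_val F (T.snd c h) x).trans n2)))
  exact dact_congr F (T.tp_snd c h).symm rfl ((cast_heq _ _).trans m2.symm)

theorem dact_sig (F : M ⟶ N) {X : T.Ob} (A : T.Ty X) (B : T.Ty (T.ext A)) (x : M.El X)
    (c : M.Fam (T.sig A B) x)
    (s : Σ a : M.Fam A x, M.Fam B (M.mk A x a)) (hs : HEq s c)
    (t : Σ a : N.Fam A (act F X x), N.Fam B (N.mk A (act F X x) a))
    (ht : HEq t (dact F (T.sig A B) x c)) :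
    HEq (dact F A x s.1) t.1 ∧ HEq (dact F B (M.mk A x s.1) s.2) t.2 := by
  have hq : T.tp (T.q (T.sig A B)) =
      T.sig (T.tySub (T.p (T.sig A B)) A) (T.tySub (T.lift (T.p (T.sig A B)) A) B) := by
    rw [T.tp_q, T.sig_sub]
  -- the elements of `Σ`-types over `x`, seen over `(x, c)`
  have key : ∀ (L : Model.{u, v, w} T) (x : L.El X) (c : L.Fam (T.sig A B) x)
      (s : Σ a : L.Fam A x, L.Fam B (L.mk A x a)) (z : L.El (T.ext (T.sig A B))),
      HEq s c → z = L.mk _ x c →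
      ∃ s' : Σ a : L.Fam (T.tySub (T.p (T.sig A B)) A) z,
        L.Fam (T.tySub (T.lift (T.p (T.sig A B)) A) B) (L.mk _ z a),
        HEq s' (L.val (T.q (T.sig A B)) z) ∧ HEq s'.1 s.1 ∧ HEq s'.2 s.2 := by
    rintro L x c s _ hs rfl
    have h1 : L.map (T.p (T.sig A B)) (L.mk _ x c) = x := by rw [map_p, split_mk]
    have hA : L.Fam A x = L.Fam (T.tySub (T.p (T.sig A B)) A) (L.mk _ x c) := by
      rw [Fam_sub]; simp only [h1]
    have e : ∀ (a : L.Fam A x) (a' : L.Fam (T.tySub (T.p (T.sig A B)) A) (L.mk _ x c)),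
        HEq a a' → L.map (T.lift (T.p (T.sig A B)) A) (L.mk _ (L.mk _ x c) a') = L.mk A x a := by
      intro a a' ha
      have h2 : L.Fam A x = L.Fam A (L.map (T.p (T.sig A B)) (L.mk _ x c)) := by rw [h1]
      rw [L.map_lift _ _ _ _ (cast h2 a) (ha.symm.trans (cast_heq _ _).symm)]
      exact L.mk_congr _ h1 (cast_heq _ _)
    have hB : ∀ (a : L.Fam A x) (a' : L.Fam (T.tySub (T.p (T.sig A B)) A) (L.mk _ x c)),
        HEq a a' → L.Fam B (L.mk A x a) =
          L.Fam (T.tySub (T.lift (T.p (T.sig A B)) A) B) (L.mk _ (L.mk _ x c) a') := by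
      intro a a' ha
      rw [Fam_sub]; simp only [e a a' ha]
    have hs1 : HEq s.1 (cast hA s.1) := (cast_heq _ _).symm
    refine ⟨⟨cast hA s.1, cast (hB _ _ hs1) s.2⟩, ?_, cast_heq _ _, cast_heq _ _⟩
    have hval : HEq (L.val (T.q (T.sig A B)) (L.mk _ x c)) c := by
      refine (L.val_q _ _).trans ?_
      rw [split_mk]
    refine HEq.trans ?_ (hs.trans hval.symm)
    exact sigma_heq_mk hA.symm (Function.hfunext hA.symm fun a' a ha =>
      heq_of_eq (hB a a' ha.symm).symm) (cast_heq _ _) (cast_heq _ _)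
  obtain ⟨s', hs', s1, s2⟩ := key M x c s _ hs rfl
  obtain ⟨t', ht', t1, t2⟩ := key N (act F X x) _ t _ ht (act_mk F _ x c)
  obtain ⟨d1, d2⟩ := dact_sig_val F _ hq (M.mk _ x c) s' hs' t' ht'
  have h1 : M.map (T.p (T.sig A B)) (M.mk _ x c) = x := by rw [map_p, split_mk]
  have hA : M.Fam A x = M.Fam A (M.map (T.p (T.sig A B)) (M.mk _ x c)) := by rw [h1]
  have e1 : HEq s'.1 (cast hA s.1) := s1.trans (cast_heq _ _).symm
  have e : M.map (T.lift (T.p (T.sig A B)) A) (M.mk _ (M.mk _ x c) s'.1) = M.mk A x s.1 := by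
    rw [M.map_lift _ _ _ _ (cast hA s.1) e1]
    exact M.mk_congr _ h1 (cast_heq _ _)
  have hB : M.Fam B (M.mk A x s.1) =
      M.Fam B (M.map (T.lift (T.p (T.sig A B)) A) (M.mk _ (M.mk _ x c) s'.1)) := by rw [e]
  constructor
  · refine HEq.trans ?_ (d1.trans t1)
    exact (dact_congr F rfl h1.symm (cast_heq hA _).symm).trans (dact_sub F _ A _ _ _ e1).symm
  · refine HEq.trans ?_ (d2.trans t2)
    exact (dact_congr F rfl e.symm (cast_heq hB _).symm).trans
      (dact_sub F _ B _ _ _ (s2.trans (cast_heq hB _).symm)).symm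

/-- The morphism of setoids induced by a morphism of `T`. -/
def kerMap (F : M ⟶ N) {X X' : T.Ob} (f : X ⟶ X') :
    SetoidObj.Hom (kerOb F X) (kerOb F X') where
  toFun x := M.map f x
  resp {x₁ x₂} h := by
    have h : act F X x₁ = act F X x₂ := h
    change act F X' (M.map f x₁) = act F X' (M.map f x₂)
    rw [act_map, act_map, h]

theorem kerTy_sub (F : M ⟶ N) {X X' : T.Ob} (f : X' ⟶ X) (Y : T.Ty X) :
    kerTy F (T.tySub f Y) = (kerTy F Y).sub (kerMap F f) := by
  refine DepSetoid.ext' (M.Fam_sub f Y) fun x x' _ a a' => ?_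
  have h1 := dact_sub F f Y x a (cast (congrFun (M.Fam_sub f Y) x) a) (cast_heq _ _).symm
  have h2 := dact_sub F f Y x' a' (cast (congrFun (M.Fam_sub f Y) x') a') (cast_heq _ _).symm
  exact ⟨fun h => h1.symm.trans (h.trans h2), fun h => h1.trans (h.trans h2.symm)⟩

/-- The section of the kernel determined by a term. -/
def kerTm (F : M ⟶ N) {X : T.Ob} (a : T.Tm X) : (kerTy F (T.tp a)).Section where
  toFun x := M.val a x
  resp {x₁ x₂} h := by
    have h : act F X x₁ = act F X x₂ := h
    refine (dact_val F a x₁).trans (HEq.trans ?_ (dact_val F a x₂).symm)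
    rw [h]

theorem tm_eq (M : Model.{u, v, w} T) {X : T.Ob} (a : T.Tm X) :
    (⟨M.Fam (T.tp a), fun x => M.val a x⟩ : Σ A : M.El X → Type v, ∀ x, A x) =
      SigmaCwF.Hom.tm M a := by
  refine Sigma.ext (M.tp_tm a).symm ?_
  exact Function.hfunext rfl fun x x' hx => by
    cases hx
    exact M.val_heq a x

theorem setoid_eqToHom_toFun {X Y : SetoidObj.{v}} (h : X = Y) (h' : X.carrier = Y.carrier)
    (x : X.carrier) : SetoidObj.Hom.toFun (eqToHom h) x = cast h' x := by
  subst h; rfl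

theorem kerOb_ext (F : M ⟶ N) {X : T.Ob} (A : T.Ty X) :
    kerOb F (T.ext A) = (kerTy F A).total := by
  refine SetoidObj.ext' (M.El_ext A) fun z z' => ?_
  change act F _ z = act F _ z' ↔ ∃ h : act F X (M.split A z).1 = act F X (M.split A z').1,
    HEq (dact F A _ (M.split A z).2) (dact F A _ (M.split A z').2)
  constructor
  · intro h
    have h' : act F X (M.split A z).1 = act F X (M.split A z').1 := by
      rw [← map_p, ← map_p, act_map, act_map, h]
    refine ⟨h', (kerTy_rel_iff F A h' _ _).2 ?_⟩
    rw [mk_split, mk_split, h]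
  · rintro ⟨h, h'⟩
    have := (kerTy_rel_iff F A h _ _).1 h'
    rwa [mk_split, mk_split] at this

theorem kerTy_unit (F : M ⟶ N) (X : T.Ob) :
    kerTy F (T.unit X) = DepSetoid.unit (kerOb F X) := by
  refine DepSetoid.ext' (M.Fam_unit X) fun x x' h a a' => ⟨fun _ => trivial, fun _ => ?_⟩
  have h : act F X x = act F X x' := h
  have key : ∀ {A B : Type v} (_ : A = PUnit) (_ : B = PUnit) (a : A) (b : B), HEq a b := by
    rintro _ _ rfl rfl a b; rfl
  exact key (congrFun (N.Fam_unit X) _) (congrFun (N.Fam_unit X) _) _ _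

theorem kerTy_sig (F : M ⟶ N) {X : T.Ob} (A : T.Ty X) (B : T.Ty (T.ext A)) :
    kerTy F (T.sig A B) =
      (kerTy F A).sig ((kerTy F B).sub
        (eqToHom (kerOb_ext F A).symm : (kerTy F A).total ⟶ kerOb F (T.ext A))) := by
  have e : ∀ (x : M.El X) (a : M.Fam A x),
      SetoidObj.Hom.toFun (eqToHom (kerOb_ext F A).symm) ⟨x, a⟩ = M.mk A x a :=
    fun x a => setoid_eqToHom_toFun _ (M.El_ext A).symm _
  have hfam : ∀ x : M.El X, (Σ a : M.Fam A x, M.Fam B (M.mk A x a)) =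
      Σ a : M.Fam A x, M.Fam B (SetoidObj.Hom.toFun (eqToHom (kerOb_ext F A).symm) ⟨x, a⟩) := by
    intro x
    simp only [e]
  refine DepSetoid.ext' ((M.Fam_sig A B).trans (funext hfam)) fun x x' h c c' => ?_
  have h : act F X x = act F X x' := h
  have key : ∀ (x : M.El X) (c : M.Fam (T.sig A B) x)
      (d : Σ a : M.Fam A x, M.Fam B (SetoidObj.Hom.toFun (eqToHom (kerOb_ext F A).symm) ⟨x, a⟩)),
      HEq d c → ∃ t : Σ a : N.Fam A (act F X x), N.Fam B (N.mk A (act F X x) a),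
        HEq t (dact F (T.sig A B) x c) ∧ HEq (dact F A x d.1) t.1 ∧
          HEq (dact F B _ d.2) t.2 := by
    intro x c d hd
    let t := cast (congrFun (N.Fam_sig A B) (act F X x)) (dact F (T.sig A B) x c)
    let s := cast (hfam x).symm d
    have ht : HEq t (dact F (T.sig A B) x c) := cast_heq _ _
    have hsd : HEq s d := cast_heq _ _
    obtain ⟨k1, k2⟩ := dact_sig F A B x c s (hsd.trans hd) t ht
    have hP : (fun a : M.Fam A x => M.Fam B (M.mk A x a)) = fun a =>
        M.Fam B (SetoidObj.Hom.toFun (eqToHom (kerOb_ext F A).symm) ⟨x, a⟩) := by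
      simp only [e]
    obtain ⟨j1, j2⟩ := sigma_heq (A := M.Fam A x) rfl (heq_of_eq hP) hsd
    have j1' := eq_of_heq j1
    refine ⟨t, ht, (heq_of_eq (congrArg _ j1'.symm)).trans k1, HEq.trans ?_ k2⟩
    exact dact_congr F rfl ((e _ _).trans (congrArg _ j1'.symm)) j2.symm
  obtain ⟨t, ht, t1, t2⟩ := key x c _ (cast_heq (congrFun ((M.Fam_sig A B).trans (funext hfam)) x) c)
  obtain ⟨t', ht', t1', t2'⟩ :=
    key x' c' _ (cast_heq (congrFun ((M.Fam_sig A B).trans (funext hfam)) x') c')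
  constructor
  · intro hc
    have htt : HEq t t' := ht.trans (HEq.trans hc ht'.symm)
    have hP : ∀ {y y' : N.El X} (_ : y = y')
        {t : Σ a : N.Fam A y, N.Fam B (N.mk A y a)} {t' : Σ a : N.Fam A y', N.Fam B (N.mk A y' a)},
        HEq t t' → HEq t.1 t'.1 ∧ HEq t.2 t'.2 := by
      rintro y _ rfl t t' htt
      cases htt
      exact ⟨HEq.rfl, HEq.rfl⟩
    obtain ⟨p1, p2⟩ := hP h htt
    exact ⟨t1.trans (p1.trans t1'.symm), t2.trans (p2.trans t2'.symm)⟩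
  · rintro ⟨p1, p2⟩
    have p1' : HEq t.1 t'.1 := t1.symm.trans (HEq.trans p1 t1')
    have p2' : HEq t.2 t'.2 := t2.symm.trans (HEq.trans p2 t2')
    have hP : ∀ {y y' : N.El X} (_ : y = y')
        {t : Σ a : N.Fam A y, N.Fam B (N.mk A y a)} {t' : Σ a : N.Fam A y', N.Fam B (N.mk A y' a)},
        HEq t.1 t'.1 → HEq t.2 t'.2 → HEq t t' := by
      rintro y _ rfl t t' h1 h2
      exact heq_of_eq (Sigma.ext (eq_of_heq h1) h2)
    exact ht.symm.trans ((hP h p1' p2').trans ht')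

theorem forget_kerTm (F : M ⟶ N) {X : T.Ob} (a : T.Tm X) :
    SigmaCwF.Hom.tm forgetSetoid (Γ := kerOb F X) ⟨kerTy F (T.tp a), kerTm F a⟩ =
      SigmaCwF.Hom.tm M a :=
  M.tm_eq a

/-- The functor underlying the kernel. -/
@[reducible]
def kerFunc (F : M ⟶ N) : T.Ob ⥤ SetoidObj.{v} where
  obj X := kerOb F X
  map f := kerMap F f
  map_id X := forgetSetoid_map_injective ((SigmaCwF.Hom.func M).map_id X)
  map_comp f g := forgetSetoid_map_injective ((SigmaCwF.Hom.func M).map_comp f g)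

theorem kerMap_p (F : M ⟶ N) {X : T.Ob} (A : T.Ty X) :
    kerMap F (T.p A) =
      (eqToHom (kerOb_ext F A) : kerOb F (T.ext A) ⟶ (kerTy F A).total) ≫ (kerTy F A).proj := by
  apply SetoidObj.Hom.ext
  funext z
  have h := setoid_eqToHom_toFun (kerOb_ext F A) (M.El_ext A) z
  exact (M.map_p A z).trans (congrArg Sigma.fst h).symm

theorem map_sec (M : Model.{u, v, w} T) {X : T.Ob} {A : T.Ty X} (a : T.Tm X) (h : T.tp a = A)
    (x : M.El X) (y : M.Fam A x) (hy : HEq y (M.val a x)) :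
    M.map (T.sec a h) x = M.mk A x y := by
  have h1 : M.map (𝟙 X) x = x := by
    unfold map
    rw [CategoryTheory.Functor.map_id]
    rfl
  have h2 : M.Fam A x = M.Fam A (M.map (𝟙 X) x) := by rw [h1]
  unfold CwF.sec
  rw [M.map_pair _ _ _ _ (cast h2 y) ((cast_heq _ _).trans hy)]
  exact M.mk_congr _ h1 (cast_heq _ _)

theorem section_cast_heq {X : SetoidObj.{v}} {A B : DepSetoid X} (h : A = B) (a : A.Section)
    (x : X.carrier) : HEq ((a.cast h).toFun x) (a.toFun x) := by
  subst h; rfl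

theorem ker_fst_snd (F : M ⟶ N) {X : T.Ob} {A : T.Ty X} {B : T.Ty (T.ext A)} (c : T.Tm X)
    (h : T.tp c = T.sig A B)
    (h' : kerTy F (T.tp c) = (kerTy F A).sig ((kerTy F B).sub
        (eqToHom (kerOb_ext F A).symm : (kerTy F A).total ⟶ kerOb F (T.ext A)))) (x : M.El X) :
    HEq (M.val (T.fst c h) x) (((kerTm F c).cast h').fst.toFun x) ∧
      HEq (M.val (T.snd c h) x) (((kerTm F c).cast h').snd.toFun x) := by
  have e : ∀ (x : M.El X) (a : M.Fam A x),
      SetoidObj.Hom.toFun (eqToHom (kerOb_ext F A).symm) ⟨x, a⟩ = M.mk A x a :=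
    fun x a => setoid_eqToHom_toFun _ (M.El_ext A).symm _
  have hP : (fun a : M.Fam A x => M.Fam B (M.mk A x a)) = fun a =>
      M.Fam B (SetoidObj.Hom.toFun (eqToHom (kerOb_ext F A).symm) ⟨x, a⟩) := by
    simp only [e]
  have hS : (Σ a : M.Fam A x, M.Fam B (M.mk A x a)) = Σ a : M.Fam A x,
      M.Fam B (SetoidObj.Hom.toFun (eqToHom (kerOb_ext F A).symm) ⟨x, a⟩) :=
    congrArg _ hP
  let d : Σ a : M.Fam A x,
      M.Fam B (SetoidObj.Hom.toFun (eqToHom (kerOb_ext F A).symm) ⟨x, a⟩) :=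
    ((kerTm F c).cast h').toFun x
  have hd : HEq d (M.val c x) := section_cast_heq h' (kerTm F c) x
  have hsd : HEq (cast hS.symm d) d := cast_heq _ _
  obtain ⟨m1, m2⟩ := M.val_fst_snd c h x (cast hS.symm d) (hsd.trans hd)
  obtain ⟨j1, j2⟩ := sigma_heq (A := M.Fam A x) rfl (heq_of_eq hP) hsd
  exact ⟨m1.trans j1, m2.trans j2⟩

theorem kerMap_sec (F : M ⟶ N) {X : T.Ob} {A : T.Ty X} (a : T.Tm X) (h : T.tp a = A)
    (s : (kerTy F A).Section) (hs : ∀ x, HEq (s.toFun x) (M.val a x)) :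
    kerMap F (T.sec a h) = DepSetoid.pair (A := kerTy F A) (𝟙 (kerOb F X) : SetoidObj.Hom _ _) s ≫
      (eqToHom (kerOb_ext F A).symm : (kerTy F A).total ⟶ kerOb F (T.ext A)) := by
  apply SetoidObj.Hom.ext
  funext x
  exact (M.map_sec a h x (s.toFun x) (hs x)).trans
    (setoid_eqToHom_toFun (kerOb_ext F A).symm (M.El_ext A).symm ⟨x, s.toFun x⟩).symm

/-- The `Σ`-CwF morphism underlying the kernel. -/
def kerHom (F : M ⟶ N) : SigmaCwF.Hom T SetoidCwF.{v} where
  func := kerFunc F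
  ty Y := kerTy F Y
  tm a := ⟨kerTy F (T.tp a), kerTm F a⟩
  ty_sub f Y := kerTy_sub F f Y
  tm_sub f a := by
    refine setoid_tm_ext ?_ ?_
    · exact (congrArg (kerTy F) (T.tp_sub f a)).trans (kerTy_sub F f _)
    · exact (forget_kerTm F _).trans ((SigmaCwF.Hom.tm_sub M f a).trans
        (congrArg (SetCwF.tmSub ((SigmaCwF.Hom.func M).map f)) (forget_kerTm F a).symm))
  tp_tm _ := rfl
  one_eq := SetoidObj.ext' (SigmaCwF.Hom.one_eq M) fun a a' => by
    refine ⟨fun _ => trivial, fun _ => ?_⟩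
    have key : ∀ {A : Type v} (_ : A = PUnit) (a b : A), a = b := by
      rintro _ rfl a b; rfl
    exact key (SigmaCwF.Hom.one_eq N) _ _
  ext_eq A := kerOb_ext F A
  p_eq A := kerMap_p F A
  q_eq A := by
    refine setoid_tm_ext ?_ ?_
    · refine (congrArg (kerTy F) (T.tp_q A)).trans ((kerTy_sub F _ _).trans ?_)
      rw [kerMap_p]
      rfl
    · refine Sigma.ext ?_ (Function.hfunext rfl fun z z' hz => ?_)
      · refine (congrArg M.Fam (T.tp_q A)).trans ((M.Fam_sub _ _).trans ?_)
        funext z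
        refine (congrArg (M.Fam A) (M.map_p A z)).trans ?_
        exact congrArg (fun t : Σ x : M.El _, M.Fam A x => M.Fam A t.1)
          (setoid_eqToHom_toFun (kerOb_ext F A) (M.El_ext A) z).symm
      · cases hz
        refine (M.val_q A z).trans ?_
        have h2 : ∀ s t : Σ x : M.El _, M.Fam A x, s = t → HEq s.2 t.2 := by
          rintro s _ rfl; rfl
        exact h2 _ _ (setoid_eqToHom_toFun (kerOb_ext F A) (M.El_ext A) z).symm
  unit_eq X := kerTy_unit F X
  sig_eq A B := kerTy_sig F A B
  fst_eq {X A B} c h h' := by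
    refine setoid_tm_ext ?_ (Sigma.ext ?_ (Function.hfunext rfl fun x x' hx => ?_))
    · exact congrArg (kerTy F) (T.tp_fst c h)
    · exact congrArg M.Fam (T.tp_fst c h)
    · cases hx
      exact (ker_fst_snd F c h h' x).1
  snd_eq {X A B} c h h' := by
    have key : kerTy F (T.tp (T.snd c h)) =
        ((kerTy F B).sub (eqToHom (kerOb_ext F A).symm :
          (kerTy F A).total ⟶ kerOb F (T.ext A))).sub
          (DepSetoid.pair (A := kerTy F A) (𝟙 (kerOb F X) : SetoidObj.Hom _ _) ((kerTm F c).cast h').fst) := by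
      rw [T.tp_snd, kerTy_sub, kerMap_sec F (T.fst c h) (T.tp_fst c h) ((kerTm F c).cast h').fst
        fun x => (ker_fst_snd F c h h' x).1.symm]
      rfl
    refine setoid_tm_ext ?_ (Sigma.ext ?_ (Function.hfunext rfl fun x x' hx => ?_))
    · exact key
    · exact congrArg DepSetoid.fam key
    · cases hx
      exact (ker_fst_snd F c h h' x).2

/-- The kernel of a morphism of models. -/
def ker (F : M ⟶ N) : Congruence M where
  hom := kerHom F
  hom_forget := by
    refine SigmaCwF.Hom.ext ?_ ?_ ?_
    · rfl
    · rfl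
    · refine heq_of_eq ?_
      funext X a
      exact M.tm_eq a

theorem ker_rel_iff (F : M ⟶ N) (X : T.Ob) (x₁ x₂ : M.El X) :
    (ker F).Rel X x₁ x₂ ↔ act F X x₁ = act F X x₂ :=
  Iff.rfl

theorem ker_depRel_iff (F : M ⟶ N) {X : T.Ob} (Y : T.Ty X) {x₁ x₂ : M.El X}
    (h : act F X x₁ = act F X x₂) (y₁ : M.Fam Y x₁) (y₂ : M.Fam Y x₂) :
    (ker F).DepRel Y h y₁ y₂ ↔ cast (congrArg (N.Fam Y) h) (dact F Y x₁ y₁) = dact F Y x₂ y₂ :=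
  cast_eq_iff_heq.symm

end Model

/-- `q : M ⟶ Q` is a quotient of the congruence `K` over `M`. -/
def IsQuotient {T : SigmaCwF.{u, w}} {M : Model.{u, v, w} T} (K : Congruence M)
    {Q : Model.{u, v, w} T} (q : M ⟶ Q) : Prop :=
  K.Le (Model.ker q) ∧
    ∀ (N : Model.{u, v, w} T) (F : M ⟶ N), K.Le (Model.ker F) → ∃! G : Q ⟶ N, q ≫ G = F

end GAT

/-! One half is soft. If all fibre maps `F_Y` are surjective, the kernel is fibrant: given `x₁ ∼ x₂`
and `y₁`, lift `F_Y(y₁)` to the fibre over `x₂`. Over a GAT every closed sort is an iterated context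
extension, so `F` is also surjective on closed sorts (`act_surjective`). A morphism that is
surjective on closed sorts is the quotient of its kernel: choose preimages (`existsUnique_factor`).

For the converse, quotients are unique up to isomorphism and trivial fibrations are stable under
composition with isomorphisms. So it suffices to construct, for a fibrant congruence, one quotient
that is a trivial fibration. The sortwise quotients `Q(X) = M_X/∼` form a functor, and fibrancy
ensures that the square of `X.A[f] ⟶ Δ.A` over `f : X ⟶ Δ` is still a pullback after quotienting
(`pullback_bijective`). Thus `Q` is a model up to isomorphism. The difficulty is strictness: a model
must send context extensions and `Σ`-types to actual sets of pairs, and substitution to actual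
reindexing.

The remedy is a strictification. Types are replaced by codes, built from delayed substitutions
`A[f]`, the unit type and `Σ`; contexts become lists of codes. A delayed substitution is interpreted
over `ξ` as the fibre of `Q(Δ.A) → Q(Δ)` over the image of `ξ` under `f`. Further substitution is
then precomposition, which is strict (`interp_sub`), and the result is a strict model of `Coded T`.
The projection `Coded T ⟶ T` lifts types and terms and is injective on terms of a fixed type. It
therefore has the right lifting property against the generating extensions, and so has a section
when `T` is a GAT (`exists_section`). Restricting along that section gives a strict model of `T`. -/

namespace GAT

/-! ### Lifting against the generating extensions, and sections over a GAT. -/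

section Lifting

/-- A morphism of `Σ`-CwFs along which types and terms lift, and which is faithful on terms. -/
structure SigmaCwF.Hom.LiftsTypesAndTerms {P T : SigmaCwF.{u, u}} (π : SigmaCwF.Hom P T) :
    Prop where
  ty_lift (Γ : P.Ob) (A : T.Ty (π.func.obj Γ)) : ∃ A' : P.Ty Γ, π.ty A' = A
  tm_lift (Γ : P.Ob) (A : P.Ty Γ) (a : T.Tm (π.func.obj Γ)) : T.tp a = π.ty A →
    ∃ a' : P.Tm Γ, P.tp a' = A ∧ π.tm a' = a
  tm_inj (Γ : P.Ob) (a b : P.Tm Γ) : P.tp a = P.tp b → π.tm a = π.tm b → a = b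

namespace SigmaCwF.Hom.LiftsTypesAndTerms

variable {P T : SigmaCwF.{u, u}} {π : P ⟶ T}

/-- In a lifting square the two contexts agree only propositionally, so the equation is stated
between dependent pairs, where no transport is needed. -/
theorem exists_ty (hπ : LiftsTypesAndTerms π) {Γ : P.Ob} {Δ : T.Ob} (h : π.func.obj Γ = Δ)
    (A : T.Ty Δ) : ∃ A' : P.Ty Γ, (⟨π.func.obj Γ, π.ty A'⟩ : Σ Δ, T.Ty Δ) = ⟨Δ, A⟩ := by
  subst h
  obtain ⟨A', rfl⟩ := hπ.ty_lift Γ A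
  exact ⟨A', rfl⟩

theorem exists_tm (hπ : LiftsTypesAndTerms π) {Γ : P.Ob} {A : P.Ty Γ} {Δ : T.Ob} (a : T.Tm Δ)
    (h : (⟨π.func.obj Γ, π.ty A⟩ : Σ Δ, T.Ty Δ) = ⟨Δ, T.tp a⟩) :
    ∃ a' : P.Tm Γ, P.tp a' = A ∧ (⟨π.func.obj Γ, π.tm a'⟩ : Σ Δ, T.Tm Δ) = ⟨Δ, a⟩ := by
  obtain ⟨h1, h2⟩ := Sigma.ext_iff.1 h
  change π.func.obj Γ = Δ at h1
  subst h1
  obtain ⟨a', ha, rfl⟩ := hπ.tm_lift Γ A a (eq_of_heq h2).symm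
  exact ⟨a', ha, rfl⟩

/-- A lift of the generic type determines the diagonal by the universal property of `D`; both
triangles commute by the uniqueness halves of the two universal properties. -/
theorem rlp_ITy (hπ : LiftsTypesAndTerms π) : ITy.rlp π := by
  rintro C D i ⟨Γ, A, hC, hD⟩
  refine ⟨fun {top bot} sq => ?_⟩
  have hΓ : π.func.obj (top.func.obj Γ) = bot.func.obj (i.func.obj Γ) :=
    congrArg (fun F : C ⟶ T => F.func.obj Γ) sq.w
  obtain ⟨A', hA'⟩ := hπ.exists_ty hΓ (bot.ty A)
  obtain ⟨F, hF, -⟩ := hD P (top.func.obj Γ) A'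
  refine ⟨⟨⟨F, ?_, ?_⟩⟩⟩
  · exact (hC P (top.func.obj Γ)).unique (congrArg Sigma.fst hF) rfl
  · refine (hD T (bot.func.obj (i.func.obj Γ)) (bot.ty A)).unique ?_ rfl
    exact (congrArg (fun z : Σ Δ, P.Ty Δ =>
      (⟨π.func.obj z.1, π.ty z.2⟩ : Σ Δ, T.Ty Δ)) hF).trans hA'

theorem rlp_ITm (hπ : LiftsTypesAndTerms π) : ITm.rlp π := by
  rintro C D i ⟨Γ, A, a, ha, hC, hD⟩
  refine ⟨fun {top bot} sq => ?_⟩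
  have hΓ : (⟨π.func.obj (top.func.obj Γ), π.ty (top.ty A)⟩ : Σ Δ, T.Ty Δ) =
      ⟨bot.func.obj (i.func.obj Γ), T.tp (bot.tm a)⟩ := by
    rw [SigmaCwF.Hom.tp_tm bot, ha]
    exact congrArg (fun F : C ⟶ T => (⟨F.func.obj Γ, F.ty A⟩ : Σ Δ, T.Ty Δ)) sq.w
  obtain ⟨a', ha', ha''⟩ := hπ.exists_tm (bot.tm a) hΓ
  obtain ⟨F, hF, -⟩ := hD P (top.func.obj Γ) a'
  refine ⟨⟨⟨F, ?_, ?_⟩⟩⟩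
  · refine (hC P (top.func.obj Γ) (top.ty A)).unique ?_ rfl
    have h1 : F.ty (i.ty A) = P.tp (F.tm a) := by rw [SigmaCwF.Hom.tp_tm F, ha]
    refine (congrArg (fun B => (⟨F.func.obj (i.func.obj Γ), B⟩ : Σ Δ, P.Ty Δ)) h1).trans ?_
    refine (congrArg (fun z : Σ Δ, P.Tm Δ => (⟨z.1, P.tp z.2⟩ : Σ Δ, P.Ty Δ)) hF).trans ?_
    exact congrArg (fun B => (⟨top.func.obj Γ, B⟩ : Σ Δ, P.Ty Δ)) ha'
  · refine (hD T (bot.func.obj (i.func.obj Γ)) (bot.tm a)).unique ?_ rfl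
    exact (congrArg (fun z : Σ Δ, P.Tm Δ =>
      (⟨π.func.obj z.1, π.tm z.2⟩ : Σ Δ, T.Tm Δ)) hF).trans ha''

/-- Here nothing is lifted. The two terms of `P` have the same type, and their images in `T` agree
because the square factors through `D`, so injectivity on terms makes them equal and the diagonal
exists. -/
theorem rlp_ETm (hπ : LiftsTypesAndTerms π) : ETm.rlp π := by
  rintro C D i ⟨Γ, x, y, ⟨hxy, hC⟩, hi, hD⟩
  refine ⟨fun {top bot} sq => ?_⟩
  have htp : P.tp (top.tm x) = P.tp (top.tm y) := by
    rw [SigmaCwF.Hom.tp_tm top, SigmaCwF.Hom.tp_tm top, hxy]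
  have hsq : (⟨π.func.obj (top.func.obj Γ), π.tm (top.tm x), π.tm (top.tm y)⟩ :
      Σ Δ, T.Tm Δ × T.Tm Δ) =
      ⟨bot.func.obj (i.func.obj Γ), bot.tm (i.tm x), bot.tm (i.tm y)⟩ :=
    congrArg (fun F : C ⟶ T => (⟨F.func.obj Γ, F.tm x, F.tm y⟩ : Σ Δ, T.Tm Δ × T.Tm Δ)) sq.w
  have heq : top.tm x = top.tm y := by
    refine hπ.tm_inj _ _ _ htp ?_
    have key : ∀ z w : Σ Δ, T.Tm Δ × T.Tm Δ, z = w → w.2.1 = w.2.2 → z.2.1 = z.2.2 := by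
      rintro z _ rfl h; exact h
    exact key _ _ hsq (congrArg _ hi)
  obtain ⟨F, hF, -⟩ := hD P (top.func.obj Γ) (top.tm x) (top.tm y) heq
  refine ⟨⟨⟨F, ?_, ?_⟩⟩⟩
  · exact (hC P (top.func.obj Γ) (top.tm x) (top.tm y) htp).unique hF rfl
  · refine (hD T (bot.func.obj (i.func.obj Γ)) (bot.tm (i.tm x)) (bot.tm (i.tm y))
      (congrArg _ hi)).unique ?_ rfl
    exact (congrArg (fun z : Σ Δ, P.Tm Δ × P.Tm Δ =>
      (⟨π.func.obj z.1, π.tm z.2.1, π.tm z.2.2⟩ : Σ Δ, T.Tm Δ × T.Tm Δ)) hF).trans hsq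

/-- A morphism to a generalized algebraic theory along which types and terms lift has a
section. -/
theorem exists_section (hπ : LiftsTypesAndTerms π) (hT : IsGAT T) : ∃ s : T ⟶ P, s ≫ π = 𝟙 T := by
  obtain ⟨Z, hZ, f, hf⟩ := hT
  -- Cellular maps lift against everything that the generators lift against.
  have h := MorphismProperty.transfiniteCompositions_pushouts_coproducts_le_llp_rlp _ _ hf
  have hr : (ITy.{u} ⊔ ITm.{u} ⊔ ETm.{u}).rlp π := by
    rintro C D i ((hi | hi) | hi)
    · exact hπ.rlp_ITy i hi
    · exact hπ.rlp_ITm i hi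
    · exact hπ.rlp_ETm i hi
  have := h π hr
  -- The square commutes by initiality of `Z`; its diagonal filler over the identity of `T` is the
  -- section.
  have sq : CommSq (hZ.to P) f π (𝟙 T) := ⟨hZ.hom_ext _ _⟩
  exact ⟨sq.lift, sq.fac_right⟩

end SigmaCwF.Hom.LiftsTypesAndTerms

end Lifting

/-! ### Calculus of substitutions in a CwF. -/

section CwFAlgebra

namespace CwF

variable (C : CwF.{u, v})

theorem pair_comp {Γ Δ Θ : C.Ob} {A : C.Ty Γ} (g : Θ ⟶ Δ) (f : Δ ⟶ Γ) (a : C.Tm Δ)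
    (h : C.tp a = C.tySub f A) :
    g ≫ C.pair f a h = C.pair (g ≫ f) (C.tmSub g a) (by rw [C.tp_sub, h, C.tySub_comp]) := by
  apply C.pair_uniq
  · rw [Category.assoc, C.pair_p, C.pair_p]
  · rw [C.tmSub_comp, C.pair_q, C.pair_q]

theorem pair_congr {Γ Δ : C.Ob} {A : C.Ty Γ} {f f' : Δ ⟶ Γ} (hf : f = f') {a a' : C.Tm Δ}
    (ha : a = a') (h : C.tp a = C.tySub f A) (h' : C.tp a' = C.tySub f' A) :
    C.pair f a h = C.pair f' a' h' := by
  subst hf ha; rfl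

theorem pair_p_q {Γ : C.Ob} (A : C.Ty Γ) : C.pair (C.p A) (C.q A) (C.tp_q A) = 𝟙 _ := by
  apply C.pair_uniq
  · rw [C.pair_p, Category.id_comp]
  · rw [C.pair_q, C.tmSub_id]

/-- The map `Δ.A₀ ⟶ Γ.A` induced by `f : Δ ⟶ Γ`, when `A₀ = A[f]`. -/
def liftOf {Γ Δ : C.Ob} (f : Δ ⟶ Γ) (A : C.Ty Γ) (A₀ : C.Ty Δ) (h : A₀ = C.tySub f A) :
    C.ext A₀ ⟶ C.ext A :=
  C.pair (C.p A₀ ≫ f) (C.q A₀) (by rw [C.tp_q, C.tySub_comp, h])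

theorem liftOf_p {Γ Δ : C.Ob} (f : Δ ⟶ Γ) (A : C.Ty Γ) (A₀ : C.Ty Δ) (h : A₀ = C.tySub f A) :
    C.liftOf f A A₀ h ≫ C.p A = C.p A₀ ≫ f :=
  C.pair_p _ _ _

theorem liftOf_q {Γ Δ : C.Ob} (f : Δ ⟶ Γ) (A : C.Ty Γ) (A₀ : C.Ty Δ) (h : A₀ = C.tySub f A) :
    C.tmSub (C.liftOf f A A₀ h) (C.q A) = C.q A₀ :=
  C.pair_q _ _ _

theorem lift_p {Γ Δ : C.Ob} (f : Δ ⟶ Γ) (A : C.Ty Γ) :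
    C.lift f A ≫ C.p A = C.p (C.tySub f A) ≫ f :=
  C.pair_p _ _ _

theorem lift_q {Γ Δ : C.Ob} (f : Δ ⟶ Γ) (A : C.Ty Γ) :
    C.tmSub (C.lift f A) (C.q A) = C.q (C.tySub f A) :=
  C.pair_q _ _ _

/-- Since `liftOf` accepts any `A₀` equal to `A[f]` as the source type, functoriality is a genuine
equation here. With `lift` the two sources `A[g ≫ f]` and `A[f][g]` differ, and only the
heterogeneous version below can be stated. -/
theorem liftOf_comp {Γ Δ Θ : C.Ob} (g : Θ ⟶ Δ) (f : Δ ⟶ Γ) (A : C.Ty Γ) (A₀ : C.Ty Δ)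
    (h : A₀ = C.tySub f A) (A₁ : C.Ty Θ) (h' : A₁ = C.tySub g A₀) :
    C.liftOf g A₀ A₁ h' ≫ C.liftOf f A A₀ h =
      C.liftOf (g ≫ f) A A₁ (by rw [h', h, C.tySub_comp]) := by
  apply C.pair_uniq
  · rw [Category.assoc, liftOf_p, liftOf_p, ← Category.assoc, liftOf_p, Category.assoc]
  · rw [C.tmSub_comp, liftOf_q, liftOf_q, liftOf_q]

theorem liftOf_heq {Γ Δ : C.Ob} (f : Δ ⟶ Γ) (A : C.Ty Γ) (A₀ A₁ : C.Ty Δ)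
    (h : A₀ = C.tySub f A) (h' : A₁ = C.tySub f A) :
    HEq (C.liftOf f A A₀ h) (C.liftOf f A A₁ h') := by
  subst h h'; rfl

theorem liftOf_id {Γ : C.Ob} (A : C.Ty Γ) :
    C.liftOf (𝟙 Γ) A A (C.tySub_id A).symm = 𝟙 (C.ext A) := by
  rw [← pair_p_q]
  exact C.pair_congr (Category.comp_id _) rfl _ _

theorem lift_id_heq {Γ : C.Ob} (A : C.Ty Γ) : HEq (C.lift (𝟙 Γ) A) (𝟙 (C.ext A)) := by
  rw [← liftOf_id]
  exact C.liftOf_heq _ _ _ _ rfl _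

theorem lift_comp_heq {Γ Δ Θ : C.Ob} (g : Θ ⟶ Δ) (f : Δ ⟶ Γ) (A : C.Ty Γ) :
    HEq (C.lift (g ≫ f) A) (C.lift g (C.tySub f A) ≫ C.lift f A) := by
  have := C.liftOf_comp g f A _ rfl _ rfl
  change C.lift g (C.tySub f A) ≫ C.lift f A = _ at this
  rw [this]
  exact C.liftOf_heq _ _ _ _ rfl _

theorem sec_comp {Γ Δ : C.Ob} (f : Δ ⟶ Γ) {A : C.Ty Γ} (a : C.Tm Γ) (h : C.tp a = A) :
    f ≫ C.sec a h = C.pair f (C.tmSub f a) (by rw [C.tp_sub, h]) := by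
  unfold sec
  rw [pair_comp]
  exact C.pair_congr (Category.comp_id _) rfl _ _

theorem sec_p {Γ : C.Ob} {A : C.Ty Γ} (a : C.Tm Γ) (h : C.tp a = A) :
    C.sec a h ≫ C.p A = 𝟙 Γ :=
  C.pair_p _ _ _

theorem sec_q {Γ : C.Ob} {A : C.Ty Γ} (a : C.Tm Γ) (h : C.tp a = A) :
    C.tmSub (C.sec a h) (C.q A) = a :=
  C.pair_q _ _ _

theorem pair_lift {Γ Δ Θ : C.Ob} (f : Δ ⟶ Γ) (A : C.Ty Γ) (g : Θ ⟶ Δ) (a : C.Tm Θ)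
    (h : C.tp a = C.tySub g (C.tySub f A)) :
    C.pair g a h ≫ C.lift f A = C.pair (g ≫ f) a (by rw [h, C.tySub_comp]) := by
  apply C.pair_uniq
  · rw [Category.assoc, lift_p, C.pair_p, ← Category.assoc, C.pair_p]
  · rw [C.tmSub_comp, lift_q, C.pair_q, C.pair_q]

theorem sec_lift {Γ Δ : C.Ob} (f : Δ ⟶ Γ) {A : C.Ty Γ} (a : C.Tm Δ)
    (h : C.tp a = C.tySub f A) : C.sec a h ≫ C.lift f A = C.pair f a h := by
  rw [sec, pair_lift]
  exact C.pair_congr (Category.id_comp _) rfl _ _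

theorem tySub_heq {X Y Z : C.Ob} (A : C.Ty X) (hYZ : Y = Z) {g : Y ⟶ X} {g' : Z ⟶ X}
    (h : HEq g g') : HEq (C.tySub g A) (C.tySub g' A) := by
  subst hYZ; cases h; rfl

/-- Both composites are `⟨f, a[f]⟩`. This is the form in which stability of terms under substitution
is used for the quotient. -/
theorem sec_sub_lift {Γ Δ : C.Ob} (f : Δ ⟶ Γ) {A : C.Ty Γ} (a : C.Tm Γ) (h : C.tp a = A) :
    C.sec (C.tmSub f a) (by rw [C.tp_sub, h]) ≫ C.lift f A = f ≫ C.sec a h := by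
  rw [sec_comp, sec_lift]

end CwF

end CwFAlgebra

/-! ### Coded types and contexts, and the strictification `Coded T`. -/

section Codes

/-- Formal presentations of the types of `T`, generated by substitution instances of the types of
`T`, the unit type and dependent sums. -/
inductive TyCode (T : SigmaCwF.{u, u}) : (X : T.Ob) → T.Ty X → Type u
  | base {X : T.Ob} {A₀ : T.Ty X} (Δ : T.Ob) (f : X ⟶ Δ) (A : T.Ty Δ) (h : A₀ = T.tySub f A) :
      TyCode T X A₀
  | unit {X : T.Ob} {A₀ : T.Ty X} (h : A₀ = T.unit X) : TyCode T X A₀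
  | sig {X : T.Ob} {A₀ : T.Ty X} (A : T.Ty X) (B : T.Ty (T.ext A)) (a : TyCode T X A)
      (b : TyCode T (T.ext A) B) (h : A₀ = T.sig A B) : TyCode T X A₀

namespace TyCode

variable {T : SigmaCwF.{u, u}}

/-- Substitution in a type code. -/
def sub {X : T.Ob} {A₀ : T.Ty X} (a : TyCode T X A₀) {X' : T.Ob} (g : X' ⟶ X) :
    TyCode T X' (T.tySub g A₀) :=
  match a with
  -- A delayed substitution absorbs `g` by composition, so substitution of codes inherits strict
  -- functoriality from composition in `T`.
  | base Δ f A h => base Δ (g ≫ f) A (by rw [h, T.tySub_comp])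
  | unit h => unit (by rw [h, T.unit_sub])
  | sig A B a b h => sig (T.tySub g A) (T.tySub (T.lift g A) B) (a.sub g) (b.sub (T.lift g A))
      (by rw [h, T.sig_sub])

theorem sub_heq {X Y Z : T.Ob} {A₀ : T.Ty X} (a : TyCode T X A₀) (hYZ : Y = Z) {g : Y ⟶ X}
    {g' : Z ⟶ X} (h : HEq g g') : HEq (a.sub g) (a.sub g') := by
  subst hYZ; cases h; rfl

theorem base_heq {X Δ : T.Ob} {A₀ A₁ : T.Ty X} (h : A₀ = A₁) {f f' : X ⟶ Δ} (hf : f = f')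
    (A : T.Ty Δ) (h₀ : A₀ = T.tySub f A) (h₁ : A₁ = T.tySub f' A) :
    HEq (base Δ f A h₀) (base Δ f' A h₁) := by
  subst h hf; rfl

theorem unit_heq {X : T.Ob} {A₀ A₁ : T.Ty X} (h₀ : A₀ = T.unit X) (h₁ : A₁ = T.unit X) :
    HEq (unit h₀) (unit h₁) := by
  subst h₀ h₁; rfl

theorem sig_heq {X : T.Ob} {A₀ A₁ : T.Ty X} (h : A₀ = A₁) {A A' : T.Ty X} (hA : A = A')
    {B : T.Ty (T.ext A)} {B' : T.Ty (T.ext A')} (hB : HEq B B') {a : TyCode T X A}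
    {a' : TyCode T X A'} (ha : HEq a a') {b : TyCode T (T.ext A) B} {b' : TyCode T (T.ext A') B'}
    (hb : HEq b b') (h₀ : A₀ = T.sig A B) (h₁ : A₁ = T.sig A' B') :
    HEq (sig A B a b h₀) (sig A' B' a' b' h₁) := by
  subst h hA; cases hB; cases ha; cases hb; rfl

theorem sub_id {X : T.Ob} {A₀ : T.Ty X} (a : TyCode T X A₀) : HEq (a.sub (𝟙 X)) a := by
  induction a with
  | base Δ f A h => exact base_heq (T.tySub_id _) (Category.id_comp _) _ _ _
  | unit h => exact unit_heq _ _
  | sig A B a b h iha ihb =>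
    have hext : T.ext (T.tySub (𝟙 _) A) = T.ext A := congrArg T.ext (T.tySub_id A)
    exact sig_heq (T.tySub_id _) (T.tySub_id _)
      ((T.tySub_heq B hext (T.lift_id_heq A)).trans (heq_of_eq (T.tySub_id B))) iha
      ((sub_heq b hext (T.lift_id_heq A)).trans ihb) _ _

/-- In the `sig` case the code `b` is substituted along `lift (g ≫ f) A`, which agrees with the
composite of two lifts only heterogeneously; `sub_heq` moves between the two sources. -/
theorem sub_comp {X : T.Ob} {A₀ : T.Ty X} (a : TyCode T X A₀) {X' X'' : T.Ob} (g : X'' ⟶ X')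
    (f : X' ⟶ X) : HEq (a.sub (g ≫ f)) ((a.sub f).sub g) := by
  induction a generalizing X' X'' with
  | base Δ k A h => exact base_heq (T.tySub_comp _ _ _) (Category.assoc _ _ _) _ _ _
  | unit h => exact unit_heq _ _
  | sig A B a b h iha ihb =>
    have hext : T.ext (T.tySub (g ≫ f) A) = T.ext (T.tySub g (T.tySub f A)) :=
      congrArg T.ext (T.tySub_comp g f A)
    exact sig_heq (T.tySub_comp _ _ _) (T.tySub_comp _ _ _)
      ((T.tySub_heq B hext (T.lift_comp_heq g f A)).trans (heq_of_eq (T.tySub_comp _ _ B)))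
      (iha g f) ((sub_heq b hext (T.lift_comp_heq g f A)).trans (ihb _ _)) _ _

end TyCode

/-- Formal presentations of the objects of `T` as iterated context extensions. -/
inductive CtxCode (T : SigmaCwF.{u, u}) : T.Ob → Type u
  | one : CtxCode T T.one
  | ext {X : T.Ob} (c : CtxCode T X) {A : T.Ty X} (a : TyCode T X A) : CtxCode T (T.ext A)

/-- A term of `T` together with a code for its type. -/
@[ext]
structure CodedTm (T : SigmaCwF.{u, u}) (X : T.Ob) : Type u where
  ty : Σ A : T.Ty X, TyCode T X A
  tm : T.Tm X
  tp_tm : T.tp tm = ty.1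

/-- An object of `T` together with a code for it. -/
structure CodedOb (T : SigmaCwF.{u, u}) : Type u where
  ob : T.Ob
  code : CtxCode T ob

/-- Morphisms of coded objects are those of `T`. -/
instance (T : SigmaCwF.{u, u}) : Category.{u} (CodedOb T) where
  Hom Γ Δ := Γ.ob ⟶ Δ.ob
  id Γ := 𝟙 Γ.ob
  comp f g := f ≫ g
  id_comp f := Category.id_comp f
  comp_id f := Category.comp_id f
  assoc f g h := Category.assoc f g h

/-- The `Σ`-CwF of coded contexts and coded types of `T`. -/
@[reducible]
def Coded (T : SigmaCwF.{u, u}) : SigmaCwF.{u, u} where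
  Ob := CodedOb T
  one := ⟨T.one, .one⟩
  toOne Γ := T.toOne Γ.ob
  toOne_uniq f := T.toOne_uniq f
  Ty Γ := Σ A : T.Ty Γ.ob, TyCode T Γ.ob A
  tySub f A := ⟨T.tySub f A.1, A.2.sub f⟩
  tySub_id A := Sigma.ext (T.tySub_id _) A.2.sub_id
  tySub_comp g f A := Sigma.ext (T.tySub_comp _ _ _) (A.2.sub_comp g f)
  Tm Γ := CodedTm T Γ.ob
  tmSub f a := ⟨⟨T.tySub f a.ty.1, a.ty.2.sub f⟩, T.tmSub f a.tm, by rw [T.tp_sub, a.tp_tm]⟩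
  tmSub_id a := CodedTm.ext (Sigma.ext (T.tySub_id _) a.ty.2.sub_id) (T.tmSub_id _)
  tmSub_comp g f a :=
    CodedTm.ext (Sigma.ext (T.tySub_comp _ _ _) (a.ty.2.sub_comp g f)) (T.tmSub_comp _ _ _)
  tp a := a.ty
  tp_sub _ _ := rfl
  ext {Γ} A := ⟨T.ext A.1, Γ.code.ext A.2⟩
  p A := T.p A.1
  q A := ⟨⟨T.tySub (T.p A.1) A.1, A.2.sub (T.p A.1)⟩, T.q A.1, T.tp_q A.1⟩
  tp_q _ := rfl
  pair f a h := T.pair f a.tm (a.tp_tm.trans (congrArg Sigma.fst h))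
  pair_p f a h := T.pair_p f a.tm _
  -- The code of the left-hand side is that of `A` substituted first along `p` and then along the
  -- pairing, hence that of `A` along `f`; `h` says that this is the code carried by `a`.
  pair_q f a h := CodedTm.ext ((Sigma.ext ((T.tySub_comp _ _ _).symm.trans
      (congrArg (fun k => T.tySub k _) (T.pair_p f a.tm _)))
    ((TyCode.sub_comp _ _ _).symm.trans (TyCode.sub_heq _ rfl (heq_of_eq (T.pair_p f a.tm _))))
    ).trans h.symm) (T.pair_q _ _ _)
  pair_uniq hp hq := T.pair_uniq hp (congrArg CodedTm.tm hq)
  unit Γ := ⟨T.unit Γ.ob, .unit rfl⟩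
  unit_sub f := Sigma.ext (T.unit_sub _) (TyCode.unit_heq _ _)
  star Γ := ⟨⟨T.unit Γ.ob, .unit rfl⟩, T.star Γ.ob, T.tp_star _⟩
  tp_star _ := rfl
  star_uniq a h := CodedTm.ext h (T.star_uniq _ (a.tp_tm.trans (congrArg Sigma.fst h)))
  sig A B := ⟨T.sig A.1 B.1, .sig A.1 B.1 A.2 B.2 rfl⟩
  sig_sub f A B := Sigma.ext (T.sig_sub _ _ _)
    (TyCode.sig_heq (T.sig_sub _ _ _) rfl HEq.rfl HEq.rfl HEq.rfl _ _)
  dpair {Γ A} B a b ha hb := ⟨⟨T.sig A.1 B.1, .sig A.1 B.1 A.2 B.2 rfl⟩,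
    T.dpair B.1 a.tm b.tm (a.tp_tm.trans (congrArg Sigma.fst ha))
      (b.tp_tm.trans (congrArg Sigma.fst hb)), T.tp_dpair _ _ _ _ _⟩
  tp_dpair _ _ _ _ _ := rfl
  fst {Γ A B} c h := ⟨A, T.fst c.tm (c.tp_tm.trans (congrArg Sigma.fst h)), T.tp_fst _ _⟩
  tp_fst _ _ := rfl
  snd {Γ A B} c h := ⟨⟨T.tySub (T.sec (T.fst c.tm (c.tp_tm.trans (congrArg Sigma.fst h)))
      (T.tp_fst _ _)) B.1, B.2.sub _⟩,
    T.snd c.tm (c.tp_tm.trans (congrArg Sigma.fst h)), T.tp_snd _ _⟩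
  tp_snd _ _ := rfl
  fst_dpair B a b ha hb := CodedTm.ext ha.symm (T.fst_dpair _ _ _ _ _)
  snd_dpair B a b ha hb := by
    refine CodedTm.ext (Eq.trans ?_ hb.symm) (T.snd_dpair _ _ _ _ _)
    have : ∀ (c : T.Tm _) (hc : T.tp c = _), c = a.tm →
      (⟨T.tySub (T.sec c hc) B.1, B.2.sub _⟩ : Σ A, TyCode T _ A) =
      ⟨T.tySub (T.sec a.tm (a.tp_tm.trans (congrArg Sigma.fst ha))) B.1, B.2.sub _⟩ := by
      rintro _ _ rfl; rfl
    exact this _ _ (T.fst_dpair _ _ _ _ _)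
  dpair_eta c h := CodedTm.ext h.symm (T.dpair_eta _ _)
  fst_sub f _ _ c h h' := CodedTm.ext rfl (T.fst_sub f c.tm _ _)
  snd_sub {Γ Δ} f A B c h h' := by
    refine CodedTm.ext ?_ (T.snd_sub f c.tm _ _)
    have h₁ : T.tp c.tm = T.sig A.1 B.1 := c.tp_tm.trans (congrArg Sigma.fst h)
    -- The code of a second projection depends on the section given by the first projection. As
    -- `fst` commutes with substitution, the two ways of substituting into it use the same morphism
    -- of `T`.
    have e : ∀ (a : T.Tm Δ.ob) (ha : T.tp a = T.tySub f A.1), a = T.tmSub f (T.fst c.tm h₁) →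
        T.sec a ha ≫ T.lift f A.1 = (show Δ.ob ⟶ Γ.ob from f) ≫ T.sec (T.fst c.tm h₁) (T.tp_fst _ _) := by
      rintro _ _ rfl
      exact T.sec_sub_lift f _ _
    have e' := e _ (T.tp_fst _ _) (T.fst_sub f c.tm h₁ (by rw [T.tp_sub, h₁, T.sig_sub]))
    refine Sigma.ext ?_ ?_
    · refine (T.tySub_comp _ _ _).symm.trans (Eq.trans ?_ (T.tySub_comp _ _ _))
      exact congrArg (fun k => T.tySub k B.1) e'
    · refine (TyCode.sub_comp _ _ _).symm.trans (HEq.trans ?_ (TyCode.sub_comp _ _ _))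
      exact TyCode.sub_heq _ rfl (heq_of_eq e')

/-- The projection from coded contexts to contexts. -/
def Coded.proj (T : SigmaCwF.{u, u}) : SigmaCwF.Hom (Coded T) T where
  func := { obj := fun Γ => Γ.ob, map := fun f => f }
  ty A := A.1
  tm a := a.tm
  ty_sub _ _ := rfl
  tm_sub _ _ := rfl
  tp_tm a := a.tp_tm
  one_eq := rfl
  ext_eq _ := rfl
  p_eq A := (Category.id_comp _).symm
  q_eq A := (T.tmSub_id _).symm
  unit_eq _ := rfl
  sig_eq A B := congrArg (T.sig A.1) (T.tySub_id _).symm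
  fst_eq {_ A B} c h h' := by
    have : ∀ (B' : T.Ty (T.ext A.1)) (_ : B' = B.1) (h₁ : T.tp c.tm = T.sig A.1 B.1)
        (h' : T.tp c.tm = T.sig A.1 B'), T.fst c.tm h₁ = T.fst c.tm h' := by rintro _ rfl _ _; rfl
    exact this _ (T.tySub_id _) _ h'
  snd_eq {_ A B} c h h' := by
    have : ∀ (B' : T.Ty (T.ext A.1)) (_ : B' = B.1) (h₁ : T.tp c.tm = T.sig A.1 B.1)
        (h' : T.tp c.tm = T.sig A.1 B'), T.snd c.tm h₁ = T.snd c.tm h' := by rintro _ rfl _ _; rfl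
    exact this _ (T.tySub_id _) _ h'

/-- Any type of `T` is its own code, as a delayed substitution along the identity. A coded term is a
term of `T` with a code for its type, so terms of a given coded type lift, and do so uniquely. -/
theorem Coded.proj_lifts (T : SigmaCwF.{u, u}) : (Coded.proj T).LiftsTypesAndTerms where
  ty_lift Γ A := ⟨⟨A, .base Γ.ob (𝟙 _) A (T.tySub_id A).symm⟩, rfl⟩
  tm_lift _ A a h := ⟨⟨A, a, h⟩, rfl, rfl⟩
  tm_inj _ _ _ h h' := CodedTm.ext h h'

/-- Codes can thus be chosen for all contexts and types of `T` at once, strictly compatibly with all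
the structure. -/
theorem IsGAT.exists_coding {T : SigmaCwF.{u, u}} (hT : IsGAT T) :
    ∃ s : SigmaCwF.Hom T (Coded T), s.comp (Coded.proj T) = SigmaCwF.Hom.id T :=
  SigmaCwF.Hom.LiftsTypesAndTerms.exists_section (π := Coded.proj T) (Coded.proj_lifts T) hT

/-- Every object of a generalized algebraic theory is an iterated context extension. -/
theorem IsGAT.nonempty_ctxCode {T : SigmaCwF.{u, u}} (hT : IsGAT T) (X : T.Ob) :
    Nonempty (CtxCode T X) := by
  obtain ⟨s, hs⟩ := hT.exists_coding
  have h : (s.func.obj X).ob = X := congrArg (fun F : SigmaCwF.Hom T T => F.func.obj X) hs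
  exact ⟨h ▸ (s.func.obj X).code⟩

end Codes

/-! ### The isomorphism between `Γ.(Σ A B)` and `Γ.A.B`, and its naturality. -/

section SigmaAlgebra

namespace SigmaCwF

variable (C : SigmaCwF.{u, v})

theorem fst_congr {Γ : C.Ob} {A A' : C.Ty Γ} (hA : A = A') {B : C.Ty (C.ext A)}
    {B' : C.Ty (C.ext A')} (hB : HEq B B') {c c' : C.Tm Γ} (hc : c = c') (h : C.tp c = C.sig A B)
    (h' : C.tp c' = C.sig A' B') : C.fst c h = C.fst c' h' := by
  subst hA hc; cases hB; rfl

theorem snd_congr {Γ : C.Ob} {A A' : C.Ty Γ} (hA : A = A') {B : C.Ty (C.ext A)}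
    {B' : C.Ty (C.ext A')} (hB : HEq B B') {c c' : C.Tm Γ} (hc : c = c') (h : C.tp c = C.sig A B)
    (h' : C.tp c' = C.sig A' B') : C.snd c h = C.snd c' h' := by
  subst hA hc; cases hB; rfl

theorem sig_congr {Γ : C.Ob} {A A' : C.Ty Γ} (hA : A = A') {B : C.Ty (C.ext A)}
    {B' : C.Ty (C.ext A')} (hB : HEq B B') : C.sig A B = C.sig A' B' := by
  subst hA; cases hB; rfl

theorem tm_ext_of_sig {Γ : C.Ob} {A : C.Ty Γ} {B : C.Ty (C.ext A)} {c c' : C.Tm Γ}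
    (h : C.tp c = C.sig A B) (h' : C.tp c' = C.sig A B) (h₁ : C.fst c h = C.fst c' h')
    (h₂ : C.snd c h = C.snd c' h') : c = c' := by
  rw [← C.dpair_eta c h, ← C.dpair_eta c' h']
  have : ∀ (a b a' b' : C.Tm Γ) (ha : C.tp a = A) (ha' : C.tp a' = A)
      (hb : C.tp b = C.tySub (C.sec a ha) B) (hb' : C.tp b' = C.tySub (C.sec a' ha') B),
      a = a' → b = b' → C.dpair B a b ha hb = C.dpair B a' b' ha' hb' := by
    rintro a b _ _ _ _ _ _ rfl rfl; rfl
  exact this _ _ _ _ _ _ _ _ h₁ h₂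

theorem tySub_sec_lift {Γ Δ : C.Ob} {A : C.Ty Γ} (B : C.Ty (C.ext A)) (f : Δ ⟶ Γ) (a : C.Tm Δ)
    (h : C.tp a = C.tySub f A) :
    C.tySub (C.sec a h) (C.tySub (C.lift f A) B) = C.tySub (C.pair f a h) B := by
  rw [← C.tySub_comp, CwF.sec_lift]

/-- The map `Δ ⟶ Γ.A.B` given by a map `f : Δ ⟶ Γ` and a term of `(Σ A B)[f]`. -/
def unpackTm {Γ Δ : C.Ob} {A : C.Ty Γ} {B : C.Ty (C.ext A)} (f : Δ ⟶ Γ) (c : C.Tm Δ)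
    (h : C.tp c = C.sig (C.tySub f A) (C.tySub (C.lift f A) B)) : Δ ⟶ C.ext B :=
  C.pair (C.pair f (C.fst c h) (C.tp_fst c h)) (C.snd c h)
    ((C.tp_snd c h).trans (C.tySub_sec_lift B f _ _))

theorem unpackTm_p {Γ Δ : C.Ob} {A : C.Ty Γ} {B : C.Ty (C.ext A)} (f : Δ ⟶ Γ) (c : C.Tm Δ)
    (h : C.tp c = C.sig (C.tySub f A) (C.tySub (C.lift f A) B)) :
    C.unpackTm f c h ≫ C.p B = C.pair f (C.fst c h) (C.tp_fst c h) :=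
  C.pair_p _ _ _

theorem unpackTm_congr {Γ Δ : C.Ob} {A : C.Ty Γ} {B : C.Ty (C.ext A)} {f f' : Δ ⟶ Γ}
    (hf : f = f') {c c' : C.Tm Δ} (hc : c = c')
    (h : C.tp c = C.sig (C.tySub f A) (C.tySub (C.lift f A) B))
    (h' : C.tp c' = C.sig (C.tySub f' A) (C.tySub (C.lift f' A) B)) :
    C.unpackTm f c h = C.unpackTm f' c' h' := by
  subst hf hc; rfl

theorem tySub_lift_comp_heq {Γ Δ Θ : C.Ob} {A : C.Ty Γ} (B : C.Ty (C.ext A)) (g : Θ ⟶ Δ)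
    (f : Δ ⟶ Γ) : HEq (C.tySub (C.lift g (C.tySub f A)) (C.tySub (C.lift f A) B))
      (C.tySub (C.lift (g ≫ f) A) B) := by
  exact (heq_of_eq (C.tySub_comp _ _ B).symm).trans
    (C.tySub_heq B (congrArg C.ext (C.tySub_comp g f A).symm) (C.lift_comp_heq g f A).symm)

/-- This is stability of `fst` and `snd` under substitution; the congruence lemmas absorb the
difference between `A[f][g]` and `A[g ≫ f]`. -/
theorem comp_unpackTm {Γ Δ Θ : C.Ob} {A : C.Ty Γ} {B : C.Ty (C.ext A)} (g : Θ ⟶ Δ) (f : Δ ⟶ Γ)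
    (c : C.Tm Δ) (h : C.tp c = C.sig (C.tySub f A) (C.tySub (C.lift f A) B))
    (h' : C.tp (C.tmSub g c) = C.sig (C.tySub (g ≫ f) A) (C.tySub (C.lift (g ≫ f) A) B)) :
    g ≫ C.unpackTm f c h = C.unpackTm (g ≫ f) (C.tmSub g c) h' := by
  have h₁ : C.tp (C.tmSub g c) = C.sig (C.tySub g (C.tySub f A))
      (C.tySub (C.lift g (C.tySub f A)) (C.tySub (C.lift f A) B)) := by
    rw [C.tp_sub, h, C.sig_sub]
  have hA := (C.tySub_comp g f A).symm
  have hB := C.tySub_lift_comp_heq B g f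
  unfold unpackTm
  rw [CwF.pair_comp]
  refine C.pair_congr ?_ ?_ _ _
  · rw [CwF.pair_comp]
    refine C.pair_congr rfl ?_ _ _
    rw [← C.fst_sub g c h h₁]
    exact C.fst_congr hA hB rfl _ _
  · rw [← C.snd_sub g c h h₁]
    exact C.snd_congr hA hB rfl _ _

/-- Projections recover `f` and both components of `c`, and eta for `Σ` recovers `c` from its
components. -/
theorem unpackTm_injective {Γ Δ : C.Ob} {A : C.Ty Γ} {B : C.Ty (C.ext A)} {f f' : Δ ⟶ Γ}
    {c c' : C.Tm Δ} {h : C.tp c = C.sig (C.tySub f A) (C.tySub (C.lift f A) B)}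
    {h' : C.tp c' = C.sig (C.tySub f' A) (C.tySub (C.lift f' A) B)}
    (e : C.unpackTm f c h = C.unpackTm f' c' h') : f = f' ∧ c = c' := by
  have e₁ : C.pair f (C.fst c h) (C.tp_fst c h) = C.pair f' (C.fst c' h') (C.tp_fst c' h') := by
    rw [← unpackTm_p, ← unpackTm_p, e]
  have hf : f = f' := by
    rw [← C.pair_p f (C.fst c h) (C.tp_fst c h), e₁, C.pair_p]
  subst hf
  refine ⟨rfl, C.tm_ext_of_sig h h' ?_ ?_⟩
  · rw [← C.pair_q f (C.fst c h) (C.tp_fst c h), e₁, C.pair_q]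
  · have := congrArg (fun k => C.tmSub k (C.q B)) e
    exact (C.pair_q _ _ _).symm.trans (this.trans (C.pair_q _ _ _))

theorem tp_q_sig {Γ : C.Ob} {A : C.Ty Γ} {B : C.Ty (C.ext A)} {S : C.Ty Γ} (h : S = C.sig A B) :
    C.tp (C.q S) = C.sig (C.tySub (C.p S) A) (C.tySub (C.lift (C.p S) A) B) := by
  rw [C.tp_q, ← C.sig_sub]
  exact congrArg _ h

/-- The canonical map `Γ.(Σ A B) ⟶ Γ.A.B`. -/
def unpack {Γ : C.Ob} (A : C.Ty Γ) (B : C.Ty (C.ext A)) (S : C.Ty Γ) (h : S = C.sig A B) :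
    C.ext S ⟶ C.ext B :=
  C.unpackTm (C.p S) (C.q S) (C.tp_q_sig h)

/-- The canonical map `Γ.A.B ⟶ Γ.(Σ A B)`. -/
def pack {Γ : C.Ob} (A : C.Ty Γ) (B : C.Ty (C.ext A)) (S : C.Ty Γ) (h : S = C.sig A B) :
    C.ext B ⟶ C.ext S :=
  C.pair (C.p B ≫ C.p A)
    (C.dpair (A := C.tySub (C.p B ≫ C.p A) A) (C.tySub (C.lift (C.p B ≫ C.p A) A) B)
      (C.tmSub (C.p B) (C.q A)) (C.q B) (by rw [C.tp_sub, C.tp_q, C.tySub_comp]) (by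
        rw [C.tp_q, tySub_sec_lift]
        congr 1
        apply C.pair_uniq
        · rw [C.pair_p]
        · rw [C.pair_q]))
    (by rw [C.tp_dpair, h, C.sig_sub])

theorem comp_unpack {Γ Δ : C.Ob} (A : C.Ty Γ) (B : C.Ty (C.ext A)) (S : C.Ty Γ)
    (h : S = C.sig A B) (k : Δ ⟶ C.ext S) :
    k ≫ C.unpack A B S h = C.unpackTm (k ≫ C.p S) (C.tmSub k (C.q S))
      (by rw [C.tp_sub, C.tp_q, ← C.tySub_comp, ← C.sig_sub]; exact congrArg _ h) :=
  C.comp_unpackTm _ _ _ _ _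

theorem pack_unpack {Γ : C.Ob} (A : C.Ty Γ) (B : C.Ty (C.ext A)) (S : C.Ty Γ)
    (h : S = C.sig A B) : C.pack A B S h ≫ C.unpack A B S h = 𝟙 _ := by
  rw [comp_unpack]
  refine (C.unpackTm_congr (C.pair_p _ _ _) (C.pair_q _ _ _) _ (C.tp_dpair _ _ _ _ _)).trans ?_
  unfold unpackTm
  rw [← CwF.pair_p_q]
  refine C.pair_congr ?_ (C.snd_dpair _ _ _ _ _) _ _
  refine C.pair_uniq (C.pair_p _ _ _) ?_
  rw [C.pair_q]
  exact C.fst_dpair _ _ _ _ _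

/-- By `unpackTm_injective`, `unpack` is a monomorphism, so this inverse law follows from
`pack_unpack` without computing with `dpair`. -/
theorem unpack_pack {Γ : C.Ob} (A : C.Ty Γ) (B : C.Ty (C.ext A)) (S : C.Ty Γ)
    (h : S = C.sig A B) : C.unpack A B S h ≫ C.pack A B S h = 𝟙 _ := by
  have e : (C.unpack A B S h ≫ C.pack A B S h) ≫ C.unpack A B S h = 𝟙 _ ≫ C.unpack A B S h := by
    rw [Category.assoc, pack_unpack, Category.id_comp, Category.comp_id]
  rw [comp_unpack, comp_unpack] at e
  obtain ⟨h₁, h₂⟩ := C.unpackTm_injective e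
  exact C.pair_uniq h₁ h₂

theorem pack_p {Γ : C.Ob} (A : C.Ty Γ) (B : C.Ty (C.ext A)) (S : C.Ty Γ)
    (h : S = C.sig A B) : C.pack A B S h ≫ C.p S = C.p B ≫ C.p A :=
  C.pair_p _ _ _

/-- Naturality of `unpack` in the context; it drives the `Σ` case of `interp_sub`. -/
theorem lift_unpack {Γ Δ : C.Ob} (g : Δ ⟶ Γ) (A : C.Ty Γ) (B : C.Ty (C.ext A)) (S : C.Ty Γ)
    (h : S = C.sig A B) (h' : C.tySub g S = C.sig (C.tySub g A) (C.tySub (C.lift g A) B)) :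
    C.lift g S ≫ C.unpack A B S h =
      C.unpack (C.tySub g A) (C.tySub (C.lift g A) B) (C.tySub g S) h' ≫
        C.lift (C.lift g A) B := by
  rw [comp_unpack]
  have e := C.tp_q_sig h'
  have hA := (C.tySub_comp (C.p (C.tySub g S)) g A).symm
  have hB := C.tySub_lift_comp_heq B (C.p (C.tySub g S)) g
  refine (C.unpackTm_congr (C.lift_p g S) (C.lift_q g S) _ (e.trans ?_)).trans ?_
  · exact C.sig_congr hA hB
  · rw [unpack, unpackTm, unpackTm, CwF.pair_lift]
    refine C.pair_congr ?_ (C.snd_congr hA.symm hB.symm rfl _ _) _ _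
    rw [CwF.pair_lift]
    exact C.pair_congr rfl (C.fst_congr hA.symm hB.symm rfl _ _) _ _

/-- Both sides are the map with components the identity, `fst c` and `snd c`. It reduces projections
of values in the quotient to sections in `T`. -/
theorem sec_unpack {Γ : C.Ob} {A : C.Ty Γ} {B : C.Ty (C.ext A)} {S : C.Ty Γ} (h : S = C.sig A B)
    (c : C.Tm Γ) (hc : C.tp c = S) (hc' : C.tp c = C.sig A B) :
    C.sec c hc ≫ C.unpack A B S h =
      C.sec (C.snd c hc') (C.tp_snd c hc') ≫ C.lift (C.sec (C.fst c hc') (C.tp_fst c hc')) B := by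
  rw [comp_unpack]
  have hA : C.tySub (𝟙 Γ) A = A := C.tySub_id A
  have hB : HEq (C.tySub (C.lift (𝟙 Γ) A) B) B := by
    exact (C.tySub_heq B (congrArg C.ext hA) (C.lift_id_heq A)).trans (heq_of_eq (C.tySub_id B))
  refine (C.unpackTm_congr (C.sec_p c hc) (C.sec_q c hc) _ (hc'.trans ?_)).trans ?_
  · exact C.sig_congr hA.symm hB.symm
  · rw [unpackTm, CwF.sec_lift]
    refine C.pair_congr ?_ (C.snd_congr hA hB rfl _ _) _ _
    exact C.pair_congr rfl (C.fst_congr hA hB rfl _ _) _ _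

end SigmaCwF

end SigmaAlgebra

/-! ### Sortwise quotients and the interpretation of type codes as families over them. -/

section Interpretation

variable {T : SigmaCwF.{u, u}}

/-- Equivalence relations on the closed sorts of a model that are preserved by the operations,
are compatible with substitution in dependent sorts, and along which elements of dependent sorts
can be transported. -/
structure StableRel (M : Model.{u, v, u} T) where
  rel (X : T.Ob) : M.El X → M.El X → Prop
  iseqv (X : T.Ob) : Equivalence (rel X)
  map {X X' : T.Ob} (f : X ⟶ X') {x y : M.El X} : rel X x y → rel X' (M.map f x) (M.map f y)
  transport {X : T.Ob} (Y : T.Ty X) {x₁ x₂ : M.El X} (h : rel X x₁ x₂) (y₁ : M.Fam Y x₁) :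
    ∃ y₂ : M.Fam Y x₂, rel (T.ext Y) (M.mk Y x₁ y₁) (M.mk Y x₂ y₂)
  of_lift {X X' : T.Ob} (f : X' ⟶ X) (Y : T.Ty X) {z z' : M.El (T.ext (T.tySub f Y))} :
    rel X' (M.map (T.p _) z) (M.map (T.p _) z') →
    rel (T.ext Y) (M.map (T.lift f Y) z) (M.map (T.lift f Y) z') → rel _ z z'

namespace StableRel

variable {M : Model.{u, v, u} T} (R : StableRel M)

/-- The quotient of a closed sort. -/
def Q (X : T.Ob) : Type v := Quotient ⟨R.rel X, R.iseqv X⟩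

/-- The class of an element. -/
def cls {X : T.Ob} (x : M.El X) : R.Q X := Quotient.mk ⟨R.rel X, R.iseqv X⟩ x

theorem cls_surjective (X : T.Ob) : Function.Surjective (R.cls (X := X)) := Quotient.mk_surjective

theorem cls_eq_iff {X : T.Ob} {x y : M.El X} : R.cls x = R.cls y ↔ R.rel X x y :=
  Quotient.eq (r := ⟨R.rel X, R.iseqv X⟩)

/-- The action of a morphism on the quotients. -/
def qmap {X X' : T.Ob} (f : X ⟶ X') : R.Q X → R.Q X' :=
  Quotient.lift (fun x => R.cls (M.map f x)) fun _ _ h => R.cls_eq_iff.2 (R.map f h)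

theorem qmap_cls {X X' : T.Ob} (f : X ⟶ X') (x : M.El X) :
    R.qmap f (R.cls x) = R.cls (M.map f x) :=
  rfl

theorem qmap_comp {X X' X'' : T.Ob} (f : X ⟶ X') (g : X' ⟶ X'') (ξ : R.Q X) :
    R.qmap (f ≫ g) ξ = R.qmap g (R.qmap f ξ) := by
  obtain ⟨x, rfl⟩ := R.cls_surjective _ ξ
  rw [qmap_cls, qmap_cls, qmap_cls, M.map_comp]

theorem qmap_id {X : T.Ob} (ξ : R.Q X) : R.qmap (𝟙 X) ξ = ξ := by
  obtain ⟨x, rfl⟩ := R.cls_surjective _ ξ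
  rw [qmap_cls]
  unfold Model.map
  rw [CategoryTheory.Functor.map_id]
  rfl

/-- The base change square of a substituted dependent sort remains a pullback in the quotients. -/
theorem pullback_bijective {X Δ : T.Ob} {A₀ : T.Ty X} (f : X ⟶ Δ) (A : T.Ty Δ)
    (h : A₀ = T.tySub f A) : Function.Bijective (fun η : R.Q (T.ext A₀) =>
      (⟨R.qmap (T.p A₀) η, R.qmap (T.liftOf f A A₀ h) η, by
        rw [← qmap_comp, ← qmap_comp, T.liftOf_p]⟩ :
      Σ ξ : R.Q X, {η : R.Q (T.ext A) // R.qmap (T.p A) η = R.qmap f ξ})) := by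
  subst h
  have key : ∀ s t : (Σ ξ : R.Q X, {η : R.Q (T.ext A) // R.qmap (T.p A) η = R.qmap f ξ}),
      s = t ↔ s.1 = t.1 ∧ s.2.1 = t.2.1 := by
    rintro ⟨ξ, η, h⟩ ⟨ξ', η', h'⟩
    constructor
    · rintro ⟨⟩; exact ⟨rfl, rfl⟩
    · rintro ⟨h₁, h₂⟩
      change ξ = ξ' at h₁
      change η = η' at h₂
      subst h₁ h₂; rfl
  constructor
  -- Injectivity is the compatibility with substitution recorded in `of_lift`.
  · intro ζ ζ' hζ
    obtain ⟨z, rfl⟩ := R.cls_surjective _ ζ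
    obtain ⟨z', rfl⟩ := R.cls_surjective _ ζ'
    obtain ⟨h₁, h₂⟩ := (key _ _).1 hζ
    exact R.cls_eq_iff.2 (R.of_lift f A (R.cls_eq_iff.1 h₁) (R.cls_eq_iff.1 h₂))
  · rintro ⟨ξ, η, h⟩
    obtain ⟨x, rfl⟩ := R.cls_surjective _ ξ
    obtain ⟨z, rfl⟩ := R.cls_surjective _ η
    have h' := R.cls_eq_iff.1 h
    rw [M.map_p] at h'
    -- The representative `z` lies over a point that is merely related to `f(x)`. Fibrancy replaces
    -- it by a related element exactly over `f(x)`, which is then an element of `A[f]` over `x`.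
    obtain ⟨y, hy⟩ := R.transport A h' (M.split A z).2
    rw [M.mk_split] at hy
    refine ⟨R.cls (M.mk _ x (cast (congrFun (M.Fam_sub f A) x).symm y)), (key _ _).2 ⟨?_, ?_⟩⟩
    · change R.cls (M.map _ _) = _
      rw [M.map_p, M.split_mk]
    · change R.cls (M.map (T.lift f A) _) = _
      rw [M.map_lift f A x _ y (cast_heq _ _)]
      exact (R.cls_eq_iff.2 hy).symm

/-- A family of sets over the quotient of `X` presenting the quotient of `X.A`. -/
structure Family (X : T.Ob) (A : T.Ty X) where
  fam : R.Q X → Type v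
  equiv : (Σ ξ, fam ξ) ≃ R.Q (T.ext A)
  qmap_p (s : Σ ξ, fam ξ) : R.qmap (T.p A) (equiv s) = s.1

variable {R}

theorem Family.exists_fam {X : T.Ob} {A : T.Ty X} (F : R.Family X A) {ξ : R.Q X}
    {η : R.Q (T.ext A)} (h : R.qmap (T.p A) η = ξ) : ∃ t : F.fam ξ, F.equiv ⟨ξ, t⟩ = η := by
  obtain ⟨⟨ξ', t⟩, rfl⟩ := F.equiv.surjective η
  rw [F.qmap_p] at h
  subst h
  exact ⟨t, rfl⟩

theorem Family.equiv_injective {X : T.Ob} {A : T.Ty X} (F : R.Family X A) {ξ ξ' : R.Q X}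
    {t : F.fam ξ} {t' : F.fam ξ'} (h : F.equiv ⟨ξ, t⟩ = F.equiv ⟨ξ', t'⟩) : HEq t t' :=
  (Sigma.ext_iff.1 (F.equiv.injective h)).2

theorem Family.equiv_congr {X : T.Ob} {A : T.Ty X} (F : R.Family X A) {ξ ξ' : R.Q X}
    (hξ : ξ = ξ') {t : F.fam ξ} {t' : F.fam ξ'} (h : HEq t t') :
    F.equiv ⟨ξ, t⟩ = F.equiv ⟨ξ', t'⟩ := by
  subst hξ; cases h; rfl

variable (R)

/-- The family of a substitution instance. -/
noncomputable def Family.base {X : T.Ob} {A₀ : T.Ty X} (Δ : T.Ob) (f : X ⟶ Δ) (A : T.Ty Δ)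
    (h : A₀ = T.tySub f A) : R.Family X A₀ where
  -- The fibre depends on `ξ` only through its image under `f`, which is why substitution into this
  -- family is strict.
  fam ξ := {η : R.Q (T.ext A) // R.qmap (T.p A) η = R.qmap f ξ}
  equiv := (Equiv.ofBijective _ (R.pullback_bijective f A h)).symm
  qmap_p s := congrArg Sigma.fst
    ((Equiv.ofBijective _ (R.pullback_bijective f A h)).apply_symm_apply s)

theorem Family.base_equiv {X : T.Ob} {A₀ : T.Ty X} (Δ : T.Ob) (f : X ⟶ Δ) (A : T.Ty Δ)
    (h : A₀ = T.tySub f A) (ξ : R.Q X) (t : (Family.base R Δ f A h).fam ξ) :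
    R.qmap (T.liftOf f A A₀ h) ((Family.base R Δ f A h).equiv ⟨ξ, t⟩) = t.1 :=
  congrArg (fun s : Σ ξ : R.Q X, {η : R.Q (T.ext A) // R.qmap (T.p A) η = R.qmap f ξ} => s.2.1)
    ((Equiv.ofBijective _ (R.pullback_bijective f A h)).apply_symm_apply ⟨ξ, t⟩)

/-- The family of the unit type. -/
def Family.unit {X : T.Ob} {A₀ : T.Ty X} (h : A₀ = T.unit X) : R.Family X A₀ where
  fam _ := PUnit
  equiv :=
    { toFun := fun s => R.qmap (T.sec (T.star X) ((T.tp_star X).trans h.symm)) s.1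
      invFun := fun η => ⟨R.qmap (T.p A₀) η, PUnit.unit⟩
      left_inv := fun s => by
        change (⟨R.qmap _ (R.qmap _ _), _⟩ : Σ _ : R.Q X, PUnit) = _
        rw [← qmap_comp, T.sec_p, qmap_id]
      right_inv := fun η => by
        -- `X.1 ⟶ X ⟶ X.1` is the identity because the unit type has only one term in each context.
        have e : T.p A₀ ≫ T.sec (T.star X) ((T.tp_star X).trans h.symm) = 𝟙 _ := by
          apply T.pair_uniq
          · rw [Category.assoc, T.sec_p, Category.comp_id, Category.id_comp]
          · rw [T.tmSub_comp, T.sec_q, T.tmSub_id,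
              T.star_uniq (T.q A₀) (by rw [T.tp_q, h, T.unit_sub])]
            exact T.star_uniq _ (by rw [T.tp_sub, T.tp_star, T.unit_sub])
        change R.qmap _ (R.qmap _ _) = _
        rw [← qmap_comp, e, qmap_id] }
  qmap_p s := by
    change R.qmap _ (R.qmap _ _) = _
    rw [← qmap_comp, T.sec_p, qmap_id]

/-- The family of a dependent sum. -/
def Family.sig {X : T.Ob} {A₀ : T.Ty X} {A : T.Ty X} {B : T.Ty (T.ext A)} (F : R.Family X A)
    (G : R.Family (T.ext A) B) (h : A₀ = T.sig A B) : R.Family X A₀ where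
  fam ξ := Σ a : F.fam ξ, G.fam (F.equiv ⟨ξ, a⟩)
  -- Reassociating the pairs and applying the equivalences of `F` and `G` lands in the quotient of
  -- `X.A.B`; `pack` carries this to the quotient of `X.(Σ A B)`.
  equiv := (((Equiv.sigmaAssoc fun ξ a => G.fam (F.equiv ⟨ξ, a⟩)).symm.trans
    (Equiv.sigmaCongrLeft F.equiv)).trans G.equiv).trans
      { toFun := R.qmap (T.pack A B A₀ h)
        invFun := R.qmap (T.unpack A B A₀ h)
        left_inv := fun η => by rw [← qmap_comp, T.pack_unpack, qmap_id]
        right_inv := fun η => by rw [← qmap_comp, T.unpack_pack, qmap_id] }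
  qmap_p s := by
    change R.qmap _ (R.qmap _ (G.equiv ⟨F.equiv ⟨s.1, s.2.1⟩, s.2.2⟩)) = _
    rw [← qmap_comp, T.pack_p, qmap_comp, G.qmap_p, F.qmap_p]

theorem Family.sig_equiv {X : T.Ob} {A₀ : T.Ty X} {A : T.Ty X} {B : T.Ty (T.ext A)}
    (F : R.Family X A) (G : R.Family (T.ext A) B) (h : A₀ = T.sig A B) (ξ : R.Q X)
    (t : (Family.sig R F G h).fam ξ) :
    R.qmap (T.unpack A B A₀ h) ((Family.sig R F G h).equiv ⟨ξ, t⟩) =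
      G.equiv ⟨F.equiv ⟨ξ, t.1⟩, t.2⟩ := by
  change R.qmap _ (R.qmap _ (G.equiv ⟨F.equiv ⟨ξ, t.1⟩, t.2⟩)) = _
  rw [← qmap_comp, T.pack_unpack, qmap_id]

/-- The family presented by a type code. -/
noncomputable def interp {X : T.Ob} {A : T.Ty X} (a : TyCode T X A) : R.Family X A :=
  match a with
  | .base Δ f A h => Family.base R Δ f A h
  | .unit h => Family.unit R h
  | .sig _ _ a b h => Family.sig R (interp a) (interp b) h

/-- The fibres are equal as sets, not only in bijection, as a strict model requires. The two claims
must be proved together: in the `Σ` case the fibres of `B` sit over elements of the quotient of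
`X.A`, so equality of the fibres of `B` needs the second claim for `A`. -/
theorem interp_sub {X : T.Ob} {A : T.Ty X} (a : TyCode T X A) {X' : T.Ob} (g : X' ⟶ X) :
    (∀ ξ, (R.interp (a.sub g)).fam ξ = (R.interp a).fam (R.qmap g ξ)) ∧
    ∀ ξ (s : (R.interp (a.sub g)).fam ξ) (t : (R.interp a).fam (R.qmap g ξ)), HEq s t →
      R.qmap (T.lift g A) ((R.interp (a.sub g)).equiv ⟨ξ, s⟩) =
        (R.interp a).equiv ⟨R.qmap g ξ, t⟩ := by
  induction a generalizing X' with
  | @base X A₀ Δ f A h =>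
    have hfam : ∀ ξ, (R.interp ((TyCode.base Δ f A h).sub g)).fam ξ =
        (R.interp (TyCode.base Δ f A h)).fam (R.qmap g ξ) := by
      intro ξ
      change {η : R.Q (T.ext A) // R.qmap (T.p A) η = R.qmap (g ≫ f) ξ} =
        {η : R.Q (T.ext A) // R.qmap (T.p A) η = R.qmap f (R.qmap g ξ)}
      rw [qmap_comp]
    refine ⟨hfam, fun ξ s t hst => ?_⟩
    have h' : T.tySub g A₀ = T.tySub (g ≫ f) A := by rw [h, T.tySub_comp]
    have hv : s.1 = t.1 := by
      have key : ∀ (ζ ζ' : R.Q Δ) (_ : ζ = ζ')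
          (s : {η : R.Q (T.ext A) // R.qmap (T.p A) η = ζ})
          (t : {η : R.Q (T.ext A) // R.qmap (T.p A) η = ζ'}), HEq s t → s.1 = t.1 := by
        rintro ζ _ rfl s t h; cases h; rfl
      exact key _ _ (R.qmap_comp g f ξ) s t hst
    -- Elements of the quotient of `X.A₀` are separated by their images in the quotients of `X` and
    -- of `Δ.A`.
    refine (R.pullback_bijective f A h).1 ?_
    have key : ∀ s t : (Σ ξ : R.Q X, {η : R.Q (T.ext A) // R.qmap (T.p A) η = R.qmap f ξ}),
        s.1 = t.1 → s.2.1 = t.2.1 → s = t := by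
      rintro ⟨ξ, η, h⟩ ⟨ξ', η', h'⟩ h₁ h₂
      change ξ = ξ' at h₁
      change η = η' at h₂
      subst h₁ h₂; rfl
    refine key _ _ ?_ ?_
    · change R.qmap _ (R.qmap _ _) = R.qmap _ _
      rw [← qmap_comp, T.lift_p, qmap_comp]
      exact (congrArg (R.qmap g) ((R.interp _).qmap_p _)).trans
        ((R.interp (TyCode.base Δ f A h)).qmap_p ⟨R.qmap g ξ, t⟩).symm
    · change R.qmap _ (R.qmap _ _) = R.qmap _ _
      refine Eq.trans ?_ (hv.trans (Family.base_equiv R Δ f A h _ t).symm)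
      refine Eq.trans ?_ (Family.base_equiv R Δ (g ≫ f) A h' _ s)
      rw [← qmap_comp]
      exact congrArg (fun k => R.qmap k _) (T.liftOf_comp g f A A₀ h _ rfl)
  | unit h =>
    refine ⟨fun ξ => rfl, fun ξ s t _ => ?_⟩
    change R.qmap _ (R.qmap _ ξ) = R.qmap _ (R.qmap g ξ)
    rw [← qmap_comp, ← qmap_comp]
    congr 1
    have := T.sec_sub_lift g (T.star _) ((T.tp_star _).trans h.symm)
    rw [← this]
    congr 1
    exact T.pair_congr rfl (T.star_uniq _ (by rw [T.tp_sub, T.tp_star, T.unit_sub])).symm _ _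
  | @sig X A₀ A B a b h iha ihb =>
    obtain ⟨fa, ea⟩ := iha g
    obtain ⟨fb, eb⟩ := ihb (T.lift g A)
    have hB : ∀ ξ (s : (R.interp (a.sub g)).fam ξ) (t : (R.interp a).fam (R.qmap g ξ)), HEq s t →
        (R.interp (b.sub (T.lift g A))).fam ((R.interp (a.sub g)).equiv ⟨ξ, s⟩) =
          (R.interp b).fam ((R.interp a).equiv ⟨R.qmap g ξ, t⟩) := by
      intro ξ s t hst
      rw [fb, ea ξ s t hst]
    have hB' : ∀ ξ, HEq
        (fun s => (R.interp (b.sub (T.lift g A))).fam ((R.interp (a.sub g)).equiv ⟨ξ, s⟩))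
        (fun t => (R.interp b).fam ((R.interp a).equiv ⟨R.qmap g ξ, t⟩)) := fun ξ =>
      Function.hfunext (fa ξ) fun s t hst => heq_of_eq (hB ξ s t hst)
    refine ⟨fun ξ => ?_, fun ξ s t hst => ?_⟩
    · have key : ∀ {A A' : Type v} (_ : A = A') {P : A → Type v} {P' : A' → Type v}
          (_ : HEq P P'), (Σ a, P a) = Σ a, P' a := by
        rintro A _ rfl P _ h; cases h; rfl
      exact key (fa ξ) (hB' ξ)
    · obtain ⟨h₁, h₂⟩ := Model.sigma_heq (fa ξ) (hB' ξ) hst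
      have h' : T.tySub g A₀ = T.sig (T.tySub g A) (T.tySub (T.lift g A) B) := by
        rw [h, T.sig_sub]
      -- Comparison after `unpack` suffices, and there the value of a pair is given by the
      -- equivalences for `a` and `b`.
      have inj : Function.Injective (R.qmap (T.unpack A B A₀ h)) := fun η η' e => by
        have := congrArg (R.qmap (T.pack A B A₀ h)) e
        rwa [← qmap_comp, ← qmap_comp, T.unpack_pack, qmap_id, qmap_id] at this
      apply inj
      refine Eq.trans ?_ (Family.sig_equiv R (R.interp a) (R.interp b) h _ t).symm
      rw [← qmap_comp, T.lift_unpack g A B A₀ h h', qmap_comp]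
      refine (congrArg _ (Family.sig_equiv R (R.interp (a.sub g))
        (R.interp (b.sub (T.lift g A))) h' ξ s)).trans ?_
      have e := ea ξ s.1 t.1 h₁
      have h₃ : (R.interp b).fam ((R.interp a).equiv ⟨R.qmap g ξ, t.1⟩) =
        (R.interp b).fam (R.qmap (T.lift g A) ((R.interp (a.sub g)).equiv ⟨ξ, s.1⟩)) := by rw [e]
      rw [eb _ s.2 (cast h₃ t.2) (h₂.trans (cast_heq _ _).symm)]
      exact Family.equiv_congr _ e (cast_heq _ _)

end StableRel

end Interpretation

/-! ### The strict quotient model of `Coded T` and its restriction to `T`. -/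

section QuotientModel

variable {T : SigmaCwF.{u, u}}

namespace StableRel

variable {M : Model.{u, v, u} T} (R : StableRel M)

/-- The set presented by a context code, with its identification with the quotient of the
underlying closed sort. -/
noncomputable def interpCtx {X : T.Ob} (c : CtxCode T X) : Σ S : Type v, S ≃ R.Q X :=
  match c with
  | .one => ⟨PUnit, Equiv.ofBijective
      (fun _ => R.cls (cast (SigmaCwF.Hom.one_eq M).symm PUnit.unit))
      ⟨fun _ _ _ => rfl, fun ξ => ⟨PUnit.unit, by
        obtain ⟨x, rfl⟩ := R.cls_surjective _ ξ
        have key : ∀ {A : Type v} (_ : A = PUnit) (a b : A), a = b := by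
          rintro _ rfl a b; rfl
        exact congrArg R.cls (key (SigmaCwF.Hom.one_eq M) _ _)⟩⟩⟩
  -- An actual set of pairs, so that `ext_eq` holds by definition; the quotient of `X.A` is only in
  -- bijection with it.
  | .ext c a => ⟨Σ s : (interpCtx c).1, (R.interp a).fam ((interpCtx c).2 s),
      (Equiv.sigmaCongrLeft (interpCtx c).2).trans (R.interp a).equiv⟩

/-- The value of a term in the quotient. -/
noncomputable def qval {X : T.Ob} {A : T.Ty X} (a : TyCode T X A) (t : T.Tm X) (h : T.tp t = A)
    (ξ : R.Q X) : (R.interp a).fam ξ :=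
  -- The choice is forced: `equiv` is injective, so the element over `ξ` with this image is unique.
  ((R.interp a).exists_fam (ξ := ξ) (η := R.qmap (T.sec t h) ξ)
    (by rw [← qmap_comp, T.sec_p, qmap_id])).choose

theorem equiv_qval {X : T.Ob} {A : T.Ty X} (a : TyCode T X A) (t : T.Tm X) (h : T.tp t = A)
    (ξ : R.Q X) : (R.interp a).equiv ⟨ξ, R.qval a t h ξ⟩ = R.qmap (T.sec t h) ξ :=
  ((R.interp a).exists_fam (ξ := ξ) (η := R.qmap (T.sec t h) ξ)
    (by rw [← qmap_comp, T.sec_p, qmap_id])).choose_spec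

/-- Values are determined by their image in the quotient of `X.A`, which turns identities between
values into identities between morphisms of `T`. -/
theorem heq_qval_iff {X : T.Ob} {A : T.Ty X} (a : TyCode T X A) (t : T.Tm X) (h : T.tp t = A)
    {ξ ξ' : R.Q X} (hξ : ξ = ξ') (y : (R.interp a).fam ξ') :
    HEq (R.qval a t h ξ) y ↔ R.qmap (T.sec t h) ξ = (R.interp a).equiv ⟨ξ', y⟩ := by
  rw [← equiv_qval R a]
  exact ⟨Family.equiv_congr _ hξ, Family.equiv_injective _⟩

theorem qval_sub {X X' : T.Ob} {A : T.Ty X} (a : TyCode T X A) (t : T.Tm X) (h : T.tp t = A)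
    (g : X' ⟶ X) (h' : T.tp (T.tmSub g t) = T.tySub g A) (ξ : R.Q X') :
    HEq (R.qval (a.sub g) (T.tmSub g t) h' ξ) (R.qval a t h (R.qmap g ξ)) := by
  obtain ⟨hf, he⟩ := R.interp_sub a g
  have e := he ξ (R.qval (a.sub g) (T.tmSub g t) h' ξ) (cast (hf ξ) (R.qval _ _ h' ξ))
    (cast_heq _ _).symm
  refine (cast_heq (hf ξ) _).symm.trans (HEq.symm ((R.heq_qval_iff a t h rfl _).2 ?_))
  rw [← e, equiv_qval, ← qmap_comp, ← qmap_comp, T.sec_sub_lift g t h]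

/-- After `unpack` and the projection to `X.A`, the section of `t` becomes the section of its first
projection, by `sec_unpack`. -/
theorem qval_fst {X : T.Ob} {A : T.Ty X} {B : T.Ty (T.ext A)} (a : TyCode T X A)
    (b : TyCode T (T.ext A) B) (t : T.Tm X) (h : T.tp t = T.sig A B) (ξ : R.Q X) :
    R.qval a (T.fst t h) (T.tp_fst t h) ξ = (R.qval (.sig A B a b rfl) t h ξ).1 := by
  apply eq_of_heq
  rw [heq_qval_iff _ _ _ _ rfl]
  have e := Family.sig_equiv R (R.interp a) (R.interp b) rfl ξ (R.qval (.sig A B a b rfl) t h ξ)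
  have e' := R.equiv_qval (.sig A B a b rfl) t h ξ
  have e₂ := congrArg (R.qmap (T.p B)) e
  rw [Family.qmap_p] at e₂
  refine Eq.trans ?_ e₂
  refine Eq.trans ?_ (congrArg (fun η => R.qmap (T.p B) (R.qmap (T.unpack A B _ rfl) η)) e').symm
  rw [← qmap_comp, ← qmap_comp, ← Category.assoc, T.sec_unpack rfl t h h, Category.assoc, T.lift_p,
    ← Category.assoc, T.sec_p, Category.id_comp]

theorem qval_snd {X : T.Ob} {A : T.Ty X} {B : T.Ty (T.ext A)} (a : TyCode T X A)
    (b : TyCode T (T.ext A) B) (t : T.Tm X) (h : T.tp t = T.sig A B) (ξ : R.Q X) :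
    HEq (R.qval (b.sub (T.sec (T.fst t h) (T.tp_fst t h))) (T.snd t h) (T.tp_snd t h) ξ)
      (R.qval (.sig A B a b rfl) t h ξ).2 := by
  obtain ⟨hf, he⟩ := R.interp_sub b (T.sec (T.fst t h) (T.tp_fst t h))
  have e₁ := he ξ _ (cast (hf ξ) (R.qval (b.sub (T.sec (T.fst t h) (T.tp_fst t h)))
    (T.snd t h) (T.tp_snd t h) ξ)) (cast_heq _ _).symm
  refine (cast_heq (hf ξ) _).symm.trans ((R.interp b).equiv_injective (e₁.symm.trans ?_))
  have e := Family.sig_equiv R (R.interp a) (R.interp b) rfl ξ (R.qval (.sig A B a b rfl) t h ξ)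
  have e' := R.equiv_qval (.sig A B a b rfl) t h ξ
  refine Eq.trans ?_ e
  refine Eq.trans ?_ (congrArg (R.qmap (T.unpack A B _ rfl)) e').symm
  rw [equiv_qval, ← qmap_comp, ← qmap_comp, T.sec_unpack rfl t h h]

/-- The action of a morphism on the sets presented by context codes. -/
noncomputable def interpMap {X X' : T.Ob} (c : CtxCode T X) (c' : CtxCode T X') (f : X ⟶ X')
    (s : (R.interpCtx c).1) : (R.interpCtx c').1 :=
  (R.interpCtx c').2.symm (R.qmap f ((R.interpCtx c).2 s))

theorem equiv_interpMap {X X' : T.Ob} (c : CtxCode T X) (c' : CtxCode T X') (f : X ⟶ X')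
    (s : (R.interpCtx c).1) :
    (R.interpCtx c').2 (R.interpMap c c' f s) = R.qmap f ((R.interpCtx c).2 s) :=
  Equiv.apply_symm_apply _ _

theorem interpMap_p {X : T.Ob} (c : CtxCode T X) {A : T.Ty X} (a : TyCode T X A)
    (z : (R.interpCtx (c.ext a)).1) : R.interpMap (c.ext a) c (T.p A) z = z.1 := by
  apply (R.interpCtx c).2.injective
  rw [equiv_interpMap]
  exact (R.interp a).qmap_p ⟨_, z.2⟩

theorem qval_q {X : T.Ob} (c : CtxCode T X) {A : T.Ty X} (a : TyCode T X A)
    (z : (R.interpCtx (c.ext a)).1) :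
    HEq (R.qval (a.sub (T.p A)) (T.q A) (T.tp_q A) ((R.interpCtx (c.ext a)).2 z)) z.2 := by
  obtain ⟨hf, he⟩ := R.interp_sub a (T.p A)
  set ξ := (R.interpCtx (c.ext a)).2 z with hξ
  have e := he ξ _ (cast (hf ξ) (R.qval (a.sub (T.p A)) (T.q A) (T.tp_q A) ξ)) (cast_heq _ _).symm
  refine (cast_heq (hf ξ) _).symm.trans ((R.interp a).equiv_injective (e.symm.trans ?_))
  rw [equiv_qval, ← qmap_comp, T.sec_lift, T.pair_p_q, qmap_id]
  exact hξ

/-- The quotient model, as a model of the coded theory. -/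
noncomputable def quotientModel : SigmaCwF.Hom (Coded T) SetCwF.{v} where
  func :=
    { obj := fun Γ => (R.interpCtx Γ.code).1
      map := fun {Γ Δ} f => ↾(R.interpMap Γ.code Δ.code f)
      map_id := fun Γ => ConcreteCategory.hom_ext _ _ fun s =>
        (R.interpCtx Γ.code).2.injective ((R.equiv_interpMap _ _ _ _).trans (R.qmap_id _))
      map_comp := fun {Γ Δ Θ} f g => ConcreteCategory.hom_ext _ _ fun s =>
        (R.interpCtx Θ.code).2.injective ((R.equiv_interpMap _ _ _ _).trans
          ((R.qmap_comp _ _ _).trans ((congrArg (R.qmap g) (R.equiv_interpMap _ _ f s).symm).trans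
            (R.equiv_interpMap _ _ _ _).symm))) }
  ty {Γ} A := fun s => (R.interp A.2).fam ((R.interpCtx Γ.code).2 s)
  tm {Γ} a := ⟨fun s => (R.interp a.ty.2).fam ((R.interpCtx Γ.code).2 s),
    fun s => R.qval a.ty.2 a.tm a.tp_tm ((R.interpCtx Γ.code).2 s)⟩
  ty_sub {Γ Δ} f A := funext fun s => ((R.interp_sub A.2 f).1 _).trans
    (congrArg (R.interp A.2).fam (R.equiv_interpMap Δ.code Γ.code f s).symm)
  tm_sub {Γ Δ} f a := by
    refine Sigma.ext (funext fun s => ((R.interp_sub a.ty.2 f).1 _).trans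
      (congrArg (R.interp a.ty.2).fam (R.equiv_interpMap Δ.code Γ.code f s).symm))
      (Function.hfunext rfl fun s s' hs => ?_)
    cases hs
    refine (R.qval_sub a.ty.2 a.tm a.tp_tm f _ _).trans ?_
    have e := R.equiv_interpMap Δ.code Γ.code f s
    exact congr_arg_heq (R.qval a.ty.2 a.tm a.tp_tm) e.symm
  tp_tm _ := rfl
  one_eq := rfl
  ext_eq _ := rfl
  p_eq {Γ} A := ConcreteCategory.hom_ext _ _ fun z => R.interpMap_p Γ.code A.2 z
  q_eq {Γ} A := by
    refine Sigma.ext (funext fun z => ?_) (Function.hfunext rfl fun z z' hz => ?_)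
    · exact ((R.interp_sub A.2 (T.p A.1)).1 _).trans
        (congrArg (R.interp A.2).fam ((R.interp A.2).qmap_p ⟨_, z.2⟩))
    · cases hz
      exact R.qval_q Γ.code A.2 z
  unit_eq _ := rfl
  sig_eq _ _ := rfl
  fst_eq {Γ A B} c h h' := by
    obtain ⟨C, c, hc⟩ := c
    -- A coded term carries the code of its type, so `h` makes that code literally a `Σ`-code, and
    -- the value of `c` is an actual pair.
    cases h
    exact Sigma.ext rfl (heq_of_eq (funext fun s => R.qval_fst A.2 B.2 c hc _))
  snd_eq {Γ A B} c h h' := by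
    obtain ⟨C, c, hc⟩ := c
    cases h
    have hf := (R.interp_sub B.2 (T.sec (T.fst c hc) (T.tp_fst c hc))).1
    refine Sigma.ext (funext fun s => ?_) (Function.hfunext rfl fun s s' hs => ?_)
    · refine (hf _).trans (congrArg (R.interp B.2).fam ?_)
      rw [← equiv_qval, R.qval_fst A.2 B.2]
      rfl
    · cases hs
      exact R.qval_snd A.2 B.2 c hc _

/-- The projection to the quotient model. -/
noncomputable def quotientMap :
    @Quiver.Hom (Model.{u, v, u} (Coded T)) _ ((Coded.proj T).comp M) R.quotientModel where
  app Γ := ↾fun x : M.El Γ.ob => (R.interpCtx Γ.code).2.symm (R.cls x)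
  naturality Γ Δ f := ConcreteCategory.hom_ext _ _ fun x =>
    congrArg (fun ξ => (R.interpCtx Δ.code).2.symm (R.qmap f ξ))
      ((R.interpCtx Γ.code).2.apply_symm_apply (R.cls (M := M) x)).symm

/-- Any stable relation on a model of a generalized algebraic theory is the kernel of a
surjective morphism of models. -/
theorem exists_quotient (hT : IsGAT T) : ∃ (Q : Model.{u, v, u} T) (q : M ⟶ Q),
    ∀ X, Function.Surjective (Model.act q X) ∧
      ∀ x y, Model.act q X x = Model.act q X y ↔ R.rel X x y := by
  obtain ⟨s, hs⟩ := hT.exists_coding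
  -- `M` is the restriction of itself along `s.comp (Coded.proj T)` only propositionally. Replacing
  -- that composite by a variable `E` allows the equation with the identity to be eliminated.
  have key : ∀ E : SigmaCwF.Hom T T, E = SigmaCwF.Hom.id T →
      (∃ (Q : Model.{u, v, u} T) (q : @Quiver.Hom (Model.{u, v, u} T) _ (E.comp M) Q),
        ∀ X, Function.Surjective (Model.act q X) ∧
        ∀ x y, Model.act q X x = Model.act q X y ↔ R.rel (E.func.obj X) x y) →
      ∃ (Q : Model.{u, v, u} T) (q : M ⟶ Q), ∀ X, Function.Surjective (Model.act q X) ∧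
        ∀ x y, Model.act q X x = Model.act q X y ↔ R.rel X x y := by
    rintro _ rfl h
    exact h
  refine key _ hs ⟨s.comp R.quotientModel, Functor.whiskerLeft s.func R.quotientMap,
    fun X => ⟨?_, fun x y => ?_⟩⟩
  · exact (R.interpCtx (s.func.obj X).code).2.symm.surjective.comp
      (R.cls_surjective (s.func.obj X).ob)
  · exact ((R.interpCtx (s.func.obj X).code).2.symm.injective.eq_iff (a := R.cls (M := M) x)
      (b := R.cls (M := M) y)).trans R.cls_eq_iff

end StableRel

end QuotientModel

/-! ### The stable relation underlying a fibrant congruence. -/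

section CongruenceRel

variable {T : SigmaCwF.{u, w}}

theorem SetoidObj.rel_iff_of_eq {A B : SetoidObj.{v}} (h : A = B) {a a' : A.carrier}
    {b b' : B.carrier} (hb : HEq a b) (hb' : HEq a' b') : A.rel a a' ↔ B.rel b b' := by
  subst h; cases hb; cases hb'; rfl

theorem DepSetoid.rel_iff_of_eq {X : SetoidObj.{v}} {A B : DepSetoid X} (h : A = B)
    {x x' : X.carrier} (k : X.rel x x') {a : A.fam x} {a' : A.fam x'} {b : B.fam x} {b' : B.fam x'}
    (hb : HEq a b) (hb' : HEq a' b') : A.rel k a a' ↔ B.rel k b b' := by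
  subst h; cases hb; cases hb'; rfl

namespace Congruence

variable {M : Model.{u, v, w} T}

/-- Context extension is preserved strictly, and in setoids it is the total setoid. Hence the
dependent relations of a congruence are determined by its relations on closed sorts. -/
theorem rel_mk_iff (K : Congruence M) {X : T.Ob} (Y : T.Ty X) {x₁ x₂ : M.El X} (y₁ : M.Fam Y x₁)
    (y₂ : M.Fam Y x₂) : K.Rel (T.ext Y) (M.mk Y x₁ y₁) (M.mk Y x₂ y₂) ↔
      ∃ h : K.Rel X x₁ x₂, K.DepRel Y h y₁ y₂ := by
  -- With `M` replaced by the underlying model of `K`, carriers and fibres agree by definition and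
  -- all casts disappear.
  obtain ⟨K, rfl⟩ := K
  have h : ∀ (x : Model.El (K.comp forgetSetoid) X) (y : Model.Fam (K.comp forgetSetoid) Y x),
      HEq (Model.mk (K.comp forgetSetoid) Y x y)
        (⟨x, y⟩ : Σ x, Model.Fam (K.comp forgetSetoid) Y x) := fun _ _ => cast_heq _ _
  exact SetoidObj.rel_iff_of_eq (K.ext_eq Y) (b := ⟨x₁, y₁⟩) (b' := ⟨x₂, y₂⟩) (h x₁ y₁) (h x₂ y₂)

/-- The relation on `Y` over `X` can be read off from the closed sort `X.Y`. -/
theorem le_of_rel {K L : Congruence M} (h : ∀ X x₁ x₂, K.Rel X x₁ x₂ → L.Rel X x₁ x₂) :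
    K.Le L :=
  ⟨h, fun _ Y _ _ y₁ y₂ k hk =>
    (L.rel_mk_iff Y y₁ y₂).1 (h _ _ _ ((K.rel_mk_iff Y y₁ y₂).2 ⟨k, hk⟩))⟩

theorem rel_equivalence (K : Congruence M) (X : T.Ob) : Equivalence (K.Rel X) := by
  obtain ⟨K, rfl⟩ := K
  exact (K.func.obj X).iseqv

theorem rel_map (K : Congruence M) {X X' : T.Ob} (f : X ⟶ X') {x y : M.El X} (h : K.Rel X x y) :
    K.Rel X' (M.map f x) (M.map f y) := by
  obtain ⟨K, rfl⟩ := K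
  exact (K.func.map f).resp h

theorem depRel_tySub (K : Congruence M) {X X' : T.Ob} (f : X' ⟶ X) (Y : T.Ty X) {x₁ x₂ : M.El X'}
    (h : K.Rel X' x₁ x₂) {a₁ : M.Fam (T.tySub f Y) x₁} {a₂ : M.Fam (T.tySub f Y) x₂}
    {b₁ : M.Fam Y (M.map f x₁)} {b₂ : M.Fam Y (M.map f x₂)} (h₁ : HEq a₁ b₁) (h₂ : HEq a₂ b₂) :
    K.DepRel (T.tySub f Y) h a₁ a₂ ↔ K.DepRel Y (K.rel_map f h) b₁ b₂ := by
  obtain ⟨K, rfl⟩ := K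
  exact DepSetoid.rel_iff_of_eq (K.ty_sub f Y) h h₁ h₂

theorem IsFibrant.exists_depRel {K : Congruence M} (hK : K.IsFibrant) {X : T.Ob} (Y : T.Ty X)
    {x₁ x₂ : M.El X} (h : K.Rel X x₁ x₂) (y₁ : M.Fam Y x₁) :
    ∃ y₂ : M.Fam Y x₂, K.DepRel Y h y₁ y₂ := by
  obtain ⟨K, rfl⟩ := K
  exact hK X Y x₁ x₂ h y₁

/-- The relations of a fibrant congruence. -/
def stableRel {T : SigmaCwF.{u, u}} {M : Model.{u, v, u} T} (K : Congruence M)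
    (hK : K.IsFibrant) : StableRel M where
  rel X := K.Rel X
  iseqv X := K.rel_equivalence X
  map f _ _ h := K.rel_map f h
  transport Y _ _ h y₁ := by
    obtain ⟨y₂, hy⟩ := hK.exists_depRel Y h y₁
    exact ⟨y₂, (K.rel_mk_iff Y _ _).2 ⟨h, hy⟩⟩
  -- With `z` and `z'` written as pairs, `h` relates the base points and `h'` the second components
  -- in `Y`; strict preservation of substitution makes these related in `Y[f]` as well.
  of_lift {X X'} f Y z z' h h' := by
    rw [M.map_p, M.map_p] at h
    have hl : ∀ z, M.map (T.lift f Y) z = M.mk Y (M.map f (M.split _ z).1)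
        (cast (congrFun (M.Fam_sub f Y) _) (M.split _ z).2) := fun z => by
      conv_lhs => rw [← M.mk_split _ z]
      exact M.map_lift f Y _ _ _ (cast_heq _ _).symm
    rw [hl, hl, K.rel_mk_iff] at h'
    rw [← M.mk_split _ z, ← M.mk_split _ z', K.rel_mk_iff]
    exact ⟨h, (K.depRel_tySub f Y h (cast_heq _ _).symm (cast_heq _ _).symm).2 h'.2⟩

end Congruence

end CongruenceRel

/-! ### Trivial fibrations, factorization through quotients, and the conclusion. -/

section TrivialFibrations

namespace Model

section

variable {T : SigmaCwF.{u, w}} {L M N : Model.{u, v, w} T}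

theorem hom_ext_act {F G : M ⟶ N} (h : ∀ X x, act F X x = act G X x) : F = G :=
  NatTrans.ext (funext fun X => ConcreteCategory.hom_ext _ _ (h X))

theorem act_comp (F : L ⟶ M) (G : M ⟶ N) (X : T.Ob) (x : L.El X) :
    act (F ≫ G) X x = act G X (act F X x) :=
  rfl

theorem act_id (X : T.Ob) (x : M.El X) : act (𝟙 M) X x = x :=
  rfl

theorem dact_eq_of_act_eq (F : M ⟶ N) {X : T.Ob} (Y : T.Ty X) {x : M.El X} {y : M.Fam Y x}
    {y' : N.Fam Y (act F X x)} (h : act F _ (M.mk Y x y) = N.mk Y (act F X x) y') :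
    dact F Y x y = y' := by
  rw [act_mk] at h
  exact eq_of_heq (N.mk_inj Y h)

/-- A morphism is a trivial fibration if its components on closed sorts are surjective and its
kernel is fibrant. -/
theorem isTrivialFibration_of_surjective {F : M ⟶ N} (hF : ∀ X, Function.Surjective (act F X))
    (hker : ∀ (X : T.Ob) (Y : T.Ty X) (x₁ x₂ : M.El X), act F X x₁ = act F X x₂ →
      ∀ y₁ : M.Fam Y x₁, ∃ y₂ : M.Fam Y x₂,
        act F _ (M.mk Y x₁ y₁) = act F _ (M.mk Y x₂ y₂)) : IsTrivialFibration F := by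
  intro X Y x y'
  -- Surjectivity on the closed sort `X.Y` gives a preimage whose base point has the same image as
  -- `x` but may differ from it; fibrancy of the kernel then moves it into the fibre over `x`.
  obtain ⟨z, hz⟩ := hF _ (N.mk Y (act F X x) y')
  have h : act F X (M.split Y z).1 = act F X x := by
    rw [← map_p, act_map, hz, map_p, split_mk]
  obtain ⟨y, hy⟩ := hker X Y _ x h (M.split Y z).2
  rw [mk_split, hz] at hy
  exact ⟨y, dact_eq_of_act_eq F Y hy.symm⟩

/-- Since `F_X(x₁) = F_X(x₂)`, the element `F_Y(y₁)` also lies in the target of the fibre map at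
`x₂`; any preimage there is the required transport. -/
theorem IsTrivialFibration.ker_isFibrant {F : M ⟶ N} (hF : IsTrivialFibration F) :
    (ker F).IsFibrant := by
  intro X Y x₁ x₂ h y₁
  have h : act F X x₁ = act F X x₂ := h
  obtain ⟨y₂, hy⟩ := hF X Y x₂ (cast (congrArg (N.Fam Y) h) (dact F Y x₁ y₁))
  exact ⟨y₂, (cast_heq _ _).symm.trans (heq_of_eq hy.symm)⟩

/-- The target element is carried back by `e.inv` to the fibre over `F_X(x)` and lifted there. -/
theorem IsTrivialFibration.comp_iso {F : L ⟶ M} (hF : IsTrivialFibration F) (e : M ≅ N) :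
    IsTrivialFibration (F ≫ e.hom) := by
  have inv_hom : ∀ X x, act e.hom X (act e.inv X x) = x := fun X x => by
    rw [← act_comp, e.inv_hom_id, act_id]
  have hom_inv : ∀ X x, act e.inv X (act e.hom X x) = x := fun X x => by
    rw [← act_comp, e.hom_inv_id, act_id]
  intro X Y x y'
  have hx : act e.inv X (act (F ≫ e.hom) X x) = act F X x := hom_inv X _
  obtain ⟨y, hy⟩ := hF X Y x (cast (congrArg (M.Fam Y) hx) (dact e.inv Y _ y'))
  refine ⟨y, dact_eq_of_act_eq _ Y ?_⟩
  rw [act_comp, act_mk F, hy]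
  have h : M.mk Y (act F X x) (cast (congrArg (M.Fam Y) hx) (dact e.inv Y _ y')) =
      act e.inv _ (N.mk Y (act (F ≫ e.hom) X x) y') := by
    rw [act_mk]
    exact M.mk_congr Y hx.symm (cast_heq _ _)
  rw [h, inv_hom]

end

variable {T : SigmaCwF.{u, u}} {M N : Model.{u, v, u} T}

/-- The definition only speaks of dependent sorts. Over a GAT closed sorts are iterated extensions:
the empty context is a singleton, and a point of `X.A` is lifted first in the base and then in the
fibre. -/
theorem IsTrivialFibration.act_surjective {F : M ⟶ N} (hF : IsTrivialFibration F) (hT : IsGAT T)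
    (X : T.Ob) : Function.Surjective (act F X) := by
  obtain ⟨c⟩ := hT.nonempty_ctxCode X
  induction c with
  | one =>
    have key : ∀ {A : Type v} (_ : A = PUnit) (a b : A), a = b := by
      rintro _ rfl a b; rfl
    exact fun y => ⟨cast (SigmaCwF.Hom.one_eq M).symm PUnit.unit,
      key (SigmaCwF.Hom.one_eq N) _ _⟩
  | @ext X c A a ih =>
    intro z
    obtain ⟨x, hx⟩ := ih (N.split A z).1
    obtain ⟨y, hy⟩ := hF X A x (cast (congrArg (N.Fam A) hx.symm) (N.split A z).2)
    refine ⟨M.mk A x y, ?_⟩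
    rw [act_mk, hy]
    exact (N.mk_congr A hx (cast_heq _ _)).trans (N.mk_split A z)

/-- A morphism with surjective components is the quotient of its kernel. -/
theorem existsUnique_factor {F : M ⟶ N} (hF : ∀ X, Function.Surjective (act F X))
    {N' : Model.{u, v, u} T} (G : M ⟶ N')
    (hG : ∀ X x y, act F X x = act F X y → act G X x = act G X y) : ∃! H : N ⟶ N', F ≫ H = G := by
  -- The preimages need not be natural; all naturality comes from `hG`, which makes `G` independent
  -- of the choice.
  choose r hr using hF
  have h : ∀ X x, act G X (r X (act F X x)) = act G X x := fun X x => hG X _ _ (hr X _)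
  refine ⟨{ app := fun X => ↾fun y : N.El X => act G X (r X y)
            naturality := fun X X' f => ConcreteCategory.hom_ext _ _ fun y => ?_ }, ?_, ?_⟩
  · change act G X' (r X' (N.map f y)) = N'.map f (act G X (r X y))
    rw [← act_map]
    -- Naturality is thereby reduced to equality of images under `F`, where the chosen preimages
    -- cancel.
    apply hG
    exact (hr X' _).trans (((congrArg (N.map f) (hr X y)).symm).trans (act_map F f _).symm)
  · exact hom_ext_act h
  · rintro H rfl
    refine hom_ext_act fun X y => ?_
    change act H X y = act H X (act F X (r X y))
    rw [hr]

theorem IsTrivialFibration.isQuotient {F : M ⟶ N} (hF : IsTrivialFibration F) (hT : IsGAT T) :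
    IsQuotient (ker F) F :=
  ⟨Congruence.le_of_rel fun _ _ _ h => h, fun _ G hG =>
    existsUnique_factor (hF.act_surjective hT) G hG.1⟩

end Model

/-- Quotients of a congruence are unique up to isomorphism. -/
theorem IsQuotient.exists_iso {T : SigmaCwF.{u, w}} {M : Model.{u, v, w} T} {K : Congruence M}
    {Q Q' : Model.{u, v, w} T} {q : M ⟶ Q} {q' : M ⟶ Q'} (h : IsQuotient K q)
    (h' : IsQuotient K q') : ∃ e : Q ≅ Q', q ≫ e.hom = q' := by
  obtain ⟨f, hf, -⟩ := h.2 Q' q' h'.1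
  obtain ⟨g, hg, -⟩ := h'.2 Q q h.1
  refine ⟨⟨f, g, (h.2 Q q h.1).unique ?_ (Category.comp_id q),
    (h'.2 Q' q' h'.1).unique ?_ (Category.comp_id q')⟩, hf⟩
  · rw [← Category.assoc, hf, hg]
  · rw [← Category.assoc, hg, hf]

/-- Over a generalized algebraic theory, every fibrant congruence has a quotient which is a
trivial fibration. -/
theorem Congruence.IsFibrant.exists_quotient {T : SigmaCwF.{u, u}} (hT : IsGAT T)
    {M : Model.{u, v, u} T} {K : Congruence M} (hK : K.IsFibrant) :
    ∃ (Q : Model.{u, v, u} T) (q : M ⟶ Q), Model.IsTrivialFibration q ∧ IsQuotient K q := by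
  obtain ⟨Q, q, hq⟩ := (K.stableRel hK).exists_quotient hT
  refine ⟨Q, q, Model.isTrivialFibration_of_surjective (fun X => (hq X).1)
    fun X Y x₁ x₂ h y₁ => ?_, Congruence.le_of_rel fun X x y h => ((hq X).2 x y).2 h,
    fun N G hG => Model.existsUnique_factor (fun X => (hq X).1) G
      fun X x y h => hG.1 X x y (((hq X).2 x y).1 h)⟩
  obtain ⟨y₂, hy⟩ := (K.stableRel hK).transport Y (((hq X).2 _ _).1 h) y₁
  exact ⟨y₂, ((hq _).2 _ _).2 hy⟩

/-- Any quotient of `K` is isomorphic under `M` to the constructed one, which is a trivial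
fibration. -/
theorem IsQuotient.isTrivialFibration {T : SigmaCwF.{u, u}} (hT : IsGAT T)
    {M Q : Model.{u, v, u} T} {K : Congruence M} (hK : K.IsFibrant) {q : M ⟶ Q}
    (hq : IsQuotient K q) : Model.IsTrivialFibration q := by
  obtain ⟨Q', q', hf, hq'⟩ := hK.exists_quotient hT
  obtain ⟨e, rfl⟩ := hq'.exists_iso hq
  exact hf.comp_iso e

end TrivialFibrations

end GAT

theorem mainTheorem4 (T : GAT.SigmaCwF.{u, u}) (hT : GAT.IsGAT T) :
    (∀ (M N : GAT.Model.{u, v, u} T) (F : M ⟶ N), GAT.Model.IsTrivialFibration F →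
      (GAT.Model.ker F).IsFibrant ∧
      GAT.IsQuotient (GAT.Model.ker F) F ∧
      ∀ (Q : GAT.Model.{u, v, u} T) (q : M ⟶ Q), GAT.IsQuotient (GAT.Model.ker F) q →
        ∃ e : Q ≅ N, q ≫ e.hom = F) ∧
    (∀ (M N : GAT.Model.{u, v, u} T) (F : M ⟶ N), GAT.Model.IsTrivialFibration F ↔
      ∃ K : GAT.Congruence M, K.IsFibrant ∧
        ∃ (Q : GAT.Model.{u, v, u} T) (q : M ⟶ Q), GAT.IsQuotient K q ∧
          ∃ e : Q ≅ N, q ≫ e.hom = F) := by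
  refine ⟨fun M N F hF => ⟨hF.ker_isFibrant, hF.isQuotient hT, fun Q q hq =>
    hq.exists_iso (hF.isQuotient hT)⟩, fun M N F => ⟨fun hF =>
    ⟨GAT.Model.ker F, hF.ker_isFibrant, N, F, hF.isQuotient hT, CategoryTheory.Iso.refl N,
      CategoryTheory.Category.comp_id F⟩, ?_⟩⟩
  rintro ⟨K, hK, Q, q, hq, e, rfl⟩
  exact (hq.isTrivialFibration hT hK).comp_iso e
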